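/- All graphs are finite, simple, undirected and connected. A biclique of a graph $H$ is a maximal (with respect to inclusion of vertex sets) induced complete bipartite subgraph of $H$, with both parts non-empty. $KB(H)$ is the intersection graph of the bicliques of $H$: its vertices are the bicliques, and two distinct bicliques are adjacent when they share a vertex. A graph is a biclique graph if it is isomorphic to $KB(H)$ for some graph $H$. $N(u)$ is the open neighbourhood of $u$; $u,u'$ are false twins if $N(u)=N(u')$; $\mathrm{Tw}(H)$ is the subgraph of $H$ induced by a set containing exactly one vertex of each class of false twins. Theorem. Let $G=KB(H)$ for some graph $H$, and let $q$ be a vertex of $G$ of degree exactly $2$. Then $G-\{q\}$ is a biclique graph: there is a graph $H'$ with $KB(H')\cong G-\{q\}$. Moreover $H'$ can be given explicitly whenever $T=\mathrm{Tw}(H)$ has at least $7$ vertices. Let $B$ be the biclique of $H$ corresponding to $q$, restricted to the vertices of $T$. Then one of the following holds. (1) $B=\{b\}\cup\{a,c\}$ with $a\neq c$, $N_T(a)=\{b\}$ and $N_T(b)=\{a,c\}$; the graph $H'=T-\{a\}$ is connected and $KB(H')\cong G-\{q\}$. (2) $B=\{v,w\}$ and there is a vertex $x$ such that $v,w,x$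 are distinct, $N_T(v)=\{w,x\}$, $N_T(w)=\{v,x\}$, and $I=N_T(x)\setminus\{v,w\}$ is an independent set. Let $S$ be obtained from $T$ by removing $v$ and $w$, adding a copy $y$ of $x$ (adjacent to exactly the vertices of $I$), a pendant vertex $x'$ adjacent to $x$, and a pendant vertex $y'$ adjacent to $y$. If some vertex $z\neq x$ of $T$ is adjacent to all vertices of $I$, put $H'=S$; otherwise put $H'=S-\{y'\}$. Then $H'$ is connected and $KB(H')\cong G-\{q\}$. -/

import Mathlib

namespace SimpleGraph

/-- The set `B` of vertices induces in `G` a complete bipartite graph, both parts of which are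
non-empty. -/
def InducesCompleteBipartite {V : Type*} (G : SimpleGraph V) (B : Set V) : Prop :=
  ∃ X Y : Set V, X.Nonempty ∧ Y.Nonempty ∧ X ∪ Y = B ∧
    G.IsIndepSet X ∧ G.IsIndepSet Y ∧ G.IsCompleteBetween X Y

/-- A biclique (given by its vertex set): a maximal induced complete bipartite subgraph. -/
def IsBiclique {V : Type*} (G : SimpleGraph V) (B : Set V) : Prop :=
  Maximal G.InducesCompleteBipartite B

/-- The biclique graph `KB(G)`: the intersection graph of the family of all bicliques of `G`. -/
def bicliqueGraph {V : Type*} (G : SimpleGraph V) :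
    SimpleGraph {B : Set V // G.IsBiclique B} where
  Adj B C := B ≠ C ∧ (B.1 ∩ C.1).Nonempty
  symm := ⟨fun _ _ h => ⟨h.1.symm, Set.inter_comm _ _ ▸ h.2⟩⟩
  loopless := ⟨fun _ h => h.1 rfl⟩

/-- `G` is (isomorphic to) the biclique graph of some finite connected graph. -/
def IsBicliqueGraph {W : Type*} (G : SimpleGraph W) : Prop :=
  ∃ (n : ℕ) (H : SimpleGraph (Fin n)), H.Connected ∧ Nonempty (G ≃g H.bicliqueGraph)

/-- `R` contains exactly one vertex of every class of false twins of `G` (vertices with the same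
open neighbourhood). The graph `Tw(G)` is then the induced subgraph `G.induce R`. -/
def IsFalseTwinTransversal {V : Type*} (G : SimpleGraph V) (R : Set V) : Prop :=
  ∀ u : V, ∃! r : V, r ∈ R ∧ G.neighborSet r = G.neighborSet u

/-- Vertices of the graph obtained by removing `v` and `w` and adding three new vertices. -/
inductive SplitVertex {V : Type*} (v w : V) : Type _
  /-- A vertex of the original graph other than `v` and `w`. -/
  | old (u : V) (hv : u ≠ v) (hw : u ≠ w) : SplitVertex v w
  /-- The copy `y` of `x`. -/
  | copy : SplitVertex v w
  /-- The pendant vertex attached to `x`. -/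
  | pendant : SplitVertex v w
  /-- The pendant vertex attached to the copy `y` of `x`. -/
  | copyPendant : SplitVertex v w

/-- Adjacency in `splitGraph`. -/
def SplitAdj {V : Type*} (G : SimpleGraph V) (v w x : V) :
    SplitVertex v w → SplitVertex v w → Prop
  | .old u _ _, .old u' _ _ => G.Adj u u'
  | .old u _ _, .copy => G.Adj u x
  | .copy, .old u _ _ => G.Adj u x
  | .old u _ _, .pendant => u = x
  | .pendant, .old u _ _ => u = x
  | .copy, .copyPendant => True
  | .copyPendant, .copy => True
  | _, _ => False

/-- The graph obtained from `G` by removing `v` and `w`, adding a copy `y` of `x` (with the same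
neighbours as `x`), a pendant vertex adjacent to `x`, and a pendant vertex adjacent to `y`. -/
def splitGraph {V : Type*} (G : SimpleGraph V) (v w x : V) : SimpleGraph (SplitVertex v w) where
  Adj := G.SplitAdj v w x
  symm := ⟨fun s t h => by
    cases s <;> cases t <;> simp only [SplitAdj] at h ⊢ <;> first | exact h | exact h.symm⟩
  loopless := ⟨fun s h => by cases s <;> simp [SplitAdj] at h⟩

end SimpleGraph

/-!
Passing to the subgraph induced by one vertex of each class of false twins does not change the
biclique graph (`IsFalseTwinTransversal.exists_iso`), so let `K` be a connected graph without false
twins, and let `B` be a biclique of `K` that meets exactly two other bicliques `C` and `D`.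

A set of vertices is complete bipartite precisely when it spans an edge and every vertex of it is
adjacent to exactly one end of each of its edges (`inducesCompleteBipartite_iff`). Every such set
lies in a biclique; hence, if it meets `B` and is not contained in `B`, it lies in `C` or in `D`
(`HasTwoNeighbors.subset_or`). As a consequence two vertices in one part of `B` that belong to the
same ones among `C` and `D` are false twins, hence equal, which makes `B` small.

If `B` is an edge `vw`, then `v` and `w` have the same other neighbours. An edge from `v` and an edge
from `w` to such a neighbour lie in different bicliques, so each of `v` and `w` lies in exactly one
of `C` and `D`; this forces a unique common neighbour `x`, whose other neighbours are independent.
If `B` has a part with two vertices, then four configurations are possible, according to whether a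
vertex outside `B` sees both ends of an edge of `B`, and whether the other part of `B` has one vertex
or more. In all of them the two constraints above determine the neighbourhoods of the vertices next
to `B`. Either `B` is a path `abc` with `a` pendant and `b` of degree two, or every biclique meets
`B`, so that there are only three, `C` and `D` intersect, and the graph has at most six vertices
(`HasTwoNeighbors.structure_or`). The graph that is just the triangle `vwx` is also of the last kind.

In the last case deleting `B` from the biclique graph leaves an edge, the biclique graph of the path
on four vertices. For the path `abc`, the bicliques other than `B` are exactly those of the graph
without `a`. For the triangle `vwx`, the bicliques that contain `v` or `w` are `B` and the closed
stars `{x, v} ∪ I` and `{x, w} ∪ I`, where `I` is the set of further neighbours of `x`. In the split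
graph these two stars become the closed stars of `x` and of its copy `y`, and a biclique that
contains `x` but neither `v` nor `w` receives `y` in addition. The only other candidate for a
biclique is `{x, y} ∪ I`. It is not maximal if a further vertex is adjacent to all of `I`; if there
is no such vertex, it plays the role of `{x, w} ∪ I` once the pendant vertex at `y` is dropped.
-/

namespace SimpleGraph

variable {U U' W : Type*} {K : SimpleGraph U} {K' : SimpleGraph U'} {G : SimpleGraph W}

/-! ### Complete bipartite sets and bicliques -/

/-- A set of vertices induces a complete bipartite graph exactly if it spans an edge and each of its
vertices is adjacent to exactly one end of each of its edges. -/
theorem inducesCompleteBipartite_iff {F : Set U} :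
    K.InducesCompleteBipartite F ↔ (∃ a ∈ F, ∃ b ∈ F, K.Adj a b) ∧
      ∀ a ∈ F, ∀ b ∈ F, ∀ c ∈ F, K.Adj a b → (K.Adj a c ↔ ¬ K.Adj b c) := by
  constructor
  · rintro ⟨X, Y, ⟨x, hx⟩, ⟨y, hy⟩, rfl, hX, hY, hXY⟩
    have iX : ∀ a ∈ X, ∀ b ∈ X, ¬ K.Adj a b := fun a ha b hb h => hX ha hb h.ne h
    have iY : ∀ a ∈ Y, ∀ b ∈ Y, ¬ K.Adj a b := fun a ha b hb h => hY ha hb h.ne h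
    have cXY : ∀ a ∈ X, ∀ b ∈ Y, K.Adj a b := fun a ha b hb => hXY ha hb
    have cYX : ∀ a ∈ X, ∀ b ∈ Y, K.Adj b a := fun a ha b hb => (hXY ha hb).symm
    refine ⟨⟨x, .inl hx, y, .inr hy, cXY x hx y hy⟩, ?_⟩
    rintro a (ha | ha) b (hb | hb) c (hc | hc) hab <;> grind
  · rintro ⟨⟨a, ha, b, hb, hab⟩, h⟩
    refine ⟨{u | u ∈ F ∧ K.Adj u b}, {u | u ∈ F ∧ K.Adj u a}, ⟨a, ha, hab⟩, ⟨b, hb, hab.symm⟩,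
      ?_, ?_, ?_, ?_⟩
    · ext u
      have := h a ha b hb u
      simp only [Set.mem_union, Set.mem_ofPred_eq, K.adj_comm u]
      grind
    · rintro u ⟨hu, hub⟩ w ⟨hw, hwb⟩ - huw
      exact (h u hu w hw b hb huw).1 hub hwb
    · rintro u ⟨hu, hub⟩ w ⟨hw, hwb⟩ - huw
      exact (h u hu w hw a ha huw).1 hub hwb
    · rintro u ⟨hu, hub⟩ w ⟨hw, hwa⟩
      have h1 := h a ha b hb w hw hab
      exact (h u hu b hb w hw hub).2 (h1.1 hwa.symm)

theorem InducesCompleteBipartite.adj_iff {F : Set U} (hF : K.InducesCompleteBipartite F)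
    {a b c : U} (ha : a ∈ F) (hb : b ∈ F) (hc : c ∈ F) (hab : K.Adj a b) :
    K.Adj a c ↔ ¬ K.Adj b c :=
  (inducesCompleteBipartite_iff.1 hF).2 a ha b hb c hc hab

theorem InducesCompleteBipartite.exists_adj {F : Set U} (hF : K.InducesCompleteBipartite F) {a : U}
    (ha : a ∈ F) : ∃ b ∈ F, K.Adj a b := by
  obtain ⟨⟨p, hp, q, hq, hpq⟩, h⟩ := inducesCompleteBipartite_iff.1 hF
  by_cases h1 : K.Adj p a
  · exact ⟨p, hp, h1.symm⟩
  · exact ⟨q, hq, by_contra fun h2 => h1 ((h p hp q hq a ha hpq).2 fun h3 => h2 h3.symm)⟩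

/-- A set which lies in an induced complete bipartite subgraph is one as soon as it spans an
edge. -/
theorem InducesCompleteBipartite.subset {F E : Set U} (hF : K.InducesCompleteBipartite F)
    (hEF : E ⊆ F) {a b : U} (ha : a ∈ E) (hb : b ∈ E) (hab : K.Adj a b) :
    K.InducesCompleteBipartite E :=
  inducesCompleteBipartite_iff.2 ⟨⟨a, ha, b, hb, hab⟩, fun _ ha _ hb _ hc =>
    hF.adj_iff (hEF ha) (hEF hb) (hEF hc)⟩

theorem InducesCompleteBipartite.exists_isBiclique [Finite U] {F : Set U}
    (hF : K.InducesCompleteBipartite F) : ∃ E, K.IsBiclique E ∧ F ⊆ E := by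
  obtain ⟨E, hFE, hE⟩ := (Set.toFinite {E | K.InducesCompleteBipartite E}).exists_le_maximal hF
  exact ⟨E, hE, hFE⟩

theorem inducesCompleteBipartite_pair {a b : U} (h : K.Adj a b) :
    K.InducesCompleteBipartite {a, b} := by
  refine inducesCompleteBipartite_iff.2 ⟨⟨a, by simp, b, by simp, h⟩, ?_⟩
  have := h.symm
  have := K.loopless
  rintro c (rfl | rfl) d (rfl | rfl) e (rfl | rfl) hcd <;> simp_all

/-- Induced paths on three vertices are complete bipartite. -/
theorem inducesCompleteBipartite_path {a b c : U} (hab : K.Adj a b) (hbc : K.Adj b c)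
    (hac : ¬ K.Adj a c) : K.InducesCompleteBipartite {a, b, c} := by
  refine inducesCompleteBipartite_iff.2 ⟨⟨a, by simp, b, by simp, hab⟩, ?_⟩
  have := hab.symm
  have := hbc.symm
  have : ¬ K.Adj c a := fun h => hac h.symm
  rintro d (rfl | rfl | rfl) e (rfl | rfl | rfl) f (rfl | rfl | rfl) hde <;> simp_all

/-- A biclique is an induced complete bipartite subgraph that no single vertex extends. -/
theorem isBiclique_iff {F : Set U} : K.IsBiclique F ↔ K.InducesCompleteBipartite F ∧
    ∀ u, K.InducesCompleteBipartite (insert u F) → u ∈ F := by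
  constructor
  · exact fun h => ⟨h.1, fun u hu => h.2 hu (Set.subset_insert u F) (Set.mem_insert u F)⟩
  · rintro ⟨hF, h⟩
    refine ⟨hF, fun E hE hFE u hu => ?_⟩
    obtain ⟨⟨a, ha, b, hb, hab⟩, -⟩ := inducesCompleteBipartite_iff.1 hF
    exact h u (hE.subset (Set.insert_subset hu hFE) (.inr ha) (.inr hb) hab)

theorem IsBiclique.eq_of_subset {E F : Set U} (hE : K.IsBiclique E) (hF : K.IsBiclique F)
    (h : E ⊆ F) : E = F :=
  h.antisymm (hE.2 hF.1 h)

/-- `B` is a biclique, and `C`, `D` are exactly the other bicliques meeting `B`: the vertex `B`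
of the biclique graph has the two neighbours `C` and `D`. -/
structure HasTwoNeighbors (K : SimpleGraph U) (B C D : Set U) : Prop where
  isB : K.IsBiclique B
  isC : K.IsBiclique C
  isD : K.IsBiclique D
  ne_CB : C ≠ B
  ne_DB : D ≠ B
  ne_CD : C ≠ D
  meetC : (B ∩ C).Nonempty
  meetD : (B ∩ D).Nonempty
  cover : ∀ F, K.IsBiclique F → (B ∩ F).Nonempty → F = B ∨ F = C ∨ F = D

namespace HasTwoNeighbors

variable {B C D : Set U}

theorem swap (h : K.HasTwoNeighbors B C D) : K.HasTwoNeighbors B D C where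
  isB := h.isB
  isC := h.isD
  isD := h.isC
  ne_CB := h.ne_DB
  ne_DB := h.ne_CB
  ne_CD := h.ne_CD.symm
  meetC := h.meetD
  meetD := h.meetC
  cover F hF hm := by rcases h.cover F hF hm with h | h | h <;> simp [h]

theorem xorB (h : K.HasTwoNeighbors B C D) (a b c : U) (ha : a ∈ B) (hb : b ∈ B) (hc : c ∈ B)
    (hab : K.Adj a b) : K.Adj a c ↔ ¬ K.Adj b c :=
  h.isB.1.adj_iff ha hb hc hab

theorem xorC (h : K.HasTwoNeighbors B C D) (a b c : U) (ha : a ∈ C) (hb : b ∈ C) (hc : c ∈ C)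
    (hab : K.Adj a b) : K.Adj a c ↔ ¬ K.Adj b c :=
  h.isC.1.adj_iff ha hb hc hab

theorem xorD (h : K.HasTwoNeighbors B C D) (a b c : U) (ha : a ∈ D) (hb : b ∈ D) (hc : c ∈ D)
    (hab : K.Adj a b) : K.Adj a c ↔ ¬ K.Adj b c :=
  h.isD.1.adj_iff ha hb hc hab

/-- The basic constraint on complete bipartite sets that meet `B` without being contained in it. -/
theorem subset_or [Finite U] (h : K.HasTwoNeighbors B C D) {F : Set U}
    (hF : K.InducesCompleteBipartite F) {b z : U} (hbF : b ∈ F) (hbB : b ∈ B) (hzF : z ∈ F)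
    (hzB : z ∉ B) : F ⊆ C ∨ F ⊆ D := by
  obtain ⟨E, hE, hFE⟩ := hF.exists_isBiclique
  rcases h.cover E hE ⟨b, hbB, hFE hbF⟩ with rfl | rfl | rfl
  · exact absurd (hFE hzF) hzB
  · exact .inl hFE
  · exact .inr hFE

theorem edge [Finite U] (h : K.HasTwoNeighbors B C D) (b z : U) (hb : b ∈ B) (hz : z ∉ B)
    (hbz : K.Adj b z) : (b ∈ C ∧ z ∈ C) ∨ (b ∈ D ∧ z ∈ D) := by
  simpa [Set.insert_subset_iff] using
    h.subset_or (inducesCompleteBipartite_pair hbz) (by simp) hb (z := z) (by simp) hz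

/-- An induced path that starts in `B` and leaves `B` at its middle vertex lies in `C` or in
`D`. -/
theorem path [Finite U] (h : K.HasTwoNeighbors B C D) (b z u : U) (hb : b ∈ B) (hz : z ∉ B)
    (hbz : K.Adj b z) (hzu : K.Adj z u) (hbu : ¬ K.Adj b u) :
    (b ∈ C ∧ z ∈ C ∧ u ∈ C) ∨ (b ∈ D ∧ z ∈ D ∧ u ∈ D) := by
  simpa [Set.insert_subset_iff] using
    h.subset_or (inducesCompleteBipartite_path hbz hzu hbu) (by simp) hb (z := z) (by simp) hz

/-- In a graph without false twins, vertices of one part of `B` are told apart by their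
membership in `C` and `D`. -/
theorem eq_of_mem_iff [Finite U] (h : K.HasTwoNeighbors B C D)
    (htw : ∀ a b, K.neighborSet a = K.neighborSet b → a = b) (p q : U) (hp : p ∈ B) (hq : q ∈ B)
    (hpq : ¬ K.Adj p q) (hC : p ∈ C ↔ q ∈ C) (hD : p ∈ D ↔ q ∈ D) : p = q := by
  have key : ∀ p q : U, p ∈ B → q ∈ B → ¬ K.Adj p q → (p ∈ C → q ∈ C) → (p ∈ D → q ∈ D) →
      ∀ z, K.Adj p z → K.Adj q z := by
    intro p q hp hq hpq hC hD z hpz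
    by_cases hz : z ∈ B
    · have := h.isB.1.adj_iff hp hz hq hpz
      rw [K.adj_comm]
      tauto
    · rw [K.adj_comm]
      rcases h.edge p z hp hz hpz with ⟨h1, h2⟩ | ⟨h1, h2⟩
      · have := h.isC.1.adj_iff h1 h2 (hC h1) hpz
        tauto
      · have := h.isD.1.adj_iff h1 h2 (hD h1) hpz
        tauto
  apply htw
  ext z
  exact ⟨key p q hp hq hpq hC.1 hD.1 z, key q p hq hp (fun h => hpq h.symm) hC.2 hD.2 z⟩

end HasTwoNeighbors

/-- In a connected graph, a non-empty set closed under adjacency contains every vertex. -/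
theorem Connected.mem_of_closed (hK : K.Connected) {S : Set U} {s : U} (hs : s ∈ S)
    (h : ∀ a ∈ S, ∀ b, K.Adj a b → b ∈ S) (u : U) : u ∈ S := by
  obtain ⟨p⟩ := hK.preconnected s u
  induction p with
  | nil => exact hs
  | cons hab _ ih => exact ih (h _ hs _ hab)

/-! ### Bicliques that are edges -/

/-- The configurations in which `B`, `C`, `D` are all the bicliques: `C` and `D` meet, every
biclique meets `B`, and there are at most six vertices. -/
structure HasFewBicliques (K : SimpleGraph U) (B C D : Set U) : Prop where
  card_le : Nat.card U ≤ 6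
  meet : (C ∩ D).Nonempty
  meetB : ∀ F, K.IsBiclique F → (B ∩ F).Nonempty

theorem HasFewBicliques.swap {B C D : Set U} (h : K.HasFewBicliques B C D) :
    K.HasFewBicliques B D C :=
  ⟨h.card_le, Set.inter_comm C D ▸ h.meet, h.meetB⟩

theorem card_le_six_of_cover [Finite U] {S T : Set U} (a b c d : U) (hS : S.Subsingleton)
    (hT : T.Subsingleton) (h : ∀ u, u = a ∨ u = b ∨ u = c ∨ u = d ∨ u ∈ S ∨ u ∈ T) :
    Nat.card U ≤ 6 := by
  have hu : (Set.univ : Set U) = ({a, b, c, d} ∪ S) ∪ T := by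
    ext u
    have := h u
    simp only [Set.mem_univ, Set.mem_union, Set.mem_insert_iff, Set.mem_singleton_iff, true_iff]
    tauto
  have h4 : ({a, b, c, d} : Set U).ncard ≤ 4 := by
    classical
    have := Finset.card_le_four (a := a) (b := b) (c := c) (d := d)
    rw [← Set.ncard_coe_finset] at this
    simpa using this
  have h1 : S.ncard ≤ 1 := (Set.ncard_le_one (Set.toFinite S)).2 fun a ha b hb => hS ha hb
  have h2 : T.ncard ≤ 1 := (Set.ncard_le_one (Set.toFinite T)).2 fun a ha b hb => hT ha hb
  have h3 := Set.ncard_union_le ({a, b, c, d} ∪ S) T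
  have h5 := Set.ncard_union_le {a, b, c, d} S
  rw [← Set.ncard_univ, hu]
  omega

theorem meetB_of_edges {B : Set U} (h : ∀ a b, K.Adj a b → a ∈ B ∨ b ∈ B) (F : Set U)
    (hF : K.IsBiclique F) :
    (B ∩ F).Nonempty := by
  obtain ⟨⟨a, ha, b, hb, hab⟩, -⟩ := inducesCompleteBipartite_iff.1 hF.1
  rcases h a b hab with h | h
  exacts [⟨a, h, ha⟩, ⟨b, h, hb⟩]

namespace HasTwoNeighbors

variable {B C D : Set U}

/-- If `B` spans a single edge `vw`, then `v` and `w` have exactly one other neighbour, which is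
common to both. -/
theorem triangle [Finite U] (h : K.HasTwoNeighbors B C D)
    (htw : ∀ a b, K.neighborSet a = K.neighborSet b → a = b)
    (hB : ∀ p ∈ B, ∀ q ∈ B, ¬ K.Adj p q → p = q) :
    ∃ v w x : U, v ≠ w ∧ v ≠ x ∧ w ≠ x ∧ B = {v, w} ∧ K.neighborSet v = {w, x} ∧
      K.neighborSet w = {v, x} ∧ K.IsIndepSet (K.neighborSet x \ {v, w}) ∧ x ∈ C ∩ D := by
  obtain ⟨⟨v, hv, w, hw, hvw⟩, -⟩ := inducesCompleteBipartite_iff.1 h.isB.1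
  have hBe : B = {v, w} := by
    ext u
    constructor
    · intro hu
      have h1 := h.isB.1.adj_iff hv hw hu hvw
      have h2 := hB v hv u hu
      have h3 := hB w hw u hu
      simp only [Set.mem_insert_iff, Set.mem_singleton_iff]
      grind
    · rintro (rfl | rfl) <;> assumption
  have hB' : ∀ u, u ∈ B ↔ u = v ∨ u = w := by simp [hBe]
  -- The two ends of the edge have the same other neighbours.
  have hnb : ∀ p ∈ B, ∀ q ∈ B, K.Adj p q → ∀ u, u ≠ q → K.Adj p u → K.Adj q u := by
    intro p hp q hq hpq u huq hpu
    by_contra hqu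
    have h1 : K.InducesCompleteBipartite {q, p, u} := inducesCompleteBipartite_path hpq.symm hpu hqu
    have h2 : B ⊆ {q, p, u} := by
      intro t ht
      have := (hB' t).1 ht
      have := (hB' p).1 hp
      have := (hB' q).1 hq
      have := hpq.ne
      simp only [Set.mem_insert_iff, Set.mem_singleton_iff]
      grind
    have h3 : u ∈ B := h.isB.2 h1 h2 (by simp)
    have := hB p hp u h3
    have := hB q hq u h3
    have := hpu.ne
    grind
  have hadj : ∀ u, u ≠ v → u ≠ w → (K.Adj v u ↔ K.Adj w u) := fun u h1 h2 =>
    ⟨hnb v hv w hw hvw u h2, hnb w hw v hv hvw.symm u h1⟩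
  obtain ⟨x, hxv, hxw, hvx⟩ : ∃ x, x ≠ v ∧ x ≠ w ∧ K.Adj v x := by
    obtain ⟨s, hsB, hsC⟩ := h.meetC
    obtain ⟨t, htC, htB⟩ : ∃ t ∈ C, t ∉ B :=
      Set.not_subset.1 fun hCB => h.ne_CB (h.isC.eq_of_subset h.isB hCB)
    obtain ⟨r, hrC, hsr⟩ := h.isC.1.exists_adj hsC
    have h1 := h.isC.1.adj_iff hsC hrC htC hsr
    have := hadj r
    have := hadj t
    have := (hB' s).1 hsB
    have := hB' r
    have := hB' t
    grind
  have hwx : K.Adj w x := (hadj x hxv hxw).1 hvx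
  have hxB : x ∉ B := by simp [hB', hxv, hxw]
  have e1 := h.edge v x hv hxB hvx
  have e2 := h.edge w x hw hxB hwx
  have t1 := fun a b c => h.isC.1.adj_iff (a := a) (b := b) (c := c)
  have t2 := fun a b c => h.isD.1.adj_iff (a := a) (b := b) (c := c)
  have hxCD : x ∈ C ∩ D := by
    refine ⟨?_, ?_⟩ <;> grind
  -- Each end lies in exactly one of `C` and `D`, which contains all induced paths from that end.
  have hone : ∀ p ∈ B, (p ∈ C → p ∉ D) := by
    intro p hp hpC hpD
    have := (hB' p).1 hp
    have := t1 v x w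
    have := t2 v x w
    grind
  -- Every complete bipartite set that contains `v` and leaves `B` lies in one biclique.
  obtain ⟨E, hE, hEv⟩ : ∃ E, K.IsBiclique E ∧ ∀ F, K.InducesCompleteBipartite F → v ∈ F →
      ∀ z ∈ F, z ∉ B → F ⊆ E := by
    by_cases hvC : v ∈ C
    · refine ⟨C, h.isC, fun F hF hvF z hz hzB => ?_⟩
      exact (h.subset_or hF hvF hv hz hzB).resolve_right fun hFD => hone v hv hvC (hFD hvF)
    · refine ⟨D, h.isD, fun F hF hvF z hz hzB => ?_⟩
      exact (h.subset_or hF hvF hv hz hzB).resolve_left fun hFC => hvC (hFC hvF)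
  have hEd : ∀ m, m ≠ w → K.Adj v m → v ∈ E ∧ m ∈ E := by
    intro m hm hvm
    have := hEv _ (inducesCompleteBipartite_pair hvm) (by simp) m (by simp)
      (by simp [hB', hm, hvm.ne'])
    simpa [Set.insert_subset_iff] using this
  have hEp : ∀ m u, m ≠ w → K.Adj v m → K.Adj m u → ¬ K.Adj v u → u ∈ E := by
    intro m u hm hvm hmu hvu
    have := hEv _ (inducesCompleteBipartite_path hvm hmu hvu) (by simp) m (by simp)
      (by simp [hB', hm, hvm.ne'])
    exact this (by simp)
  have tE := fun a b c => hE.1.adj_iff (a := a) (b := b) (c := c)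
  have huniq : ∀ m, m ≠ w → K.Adj v m → m = x := by
    have key : ∀ m m', m ≠ w → m' ≠ w → K.Adj v m → K.Adj v m' → ∀ u, K.Adj m u → K.Adj m' u := by
      intro m m' hm hm' hvm hvm' u hmu
      have a1 := hEd m hm hvm
      have a2 := hEd m' hm' hvm'
      by_cases hvu : K.Adj v u
      · by_cases huw : u = w
        · subst huw
          exact ((hadj m' hvm'.ne' hm').1 hvm').symm
        · have a3 := hEd u huw hvu
          have := tE v m u a1.1 a1.2 a3.2 hvm
          grind
      · have a3 := hEp m u hm hvm hmu hvu
        have := tE v m u a1.1 a1.2 a3 hvm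
        have := tE v m' u a1.1 a2.2 a3 hvm'
        grind
    intro m hm hvm
    apply htw
    ext u
    exact ⟨key m x hm hxw hvm hvx u, key x m hxw hm hvx hvm u⟩
  refine ⟨v, w, x, hvw.ne, hxv.symm, hxw.symm, hBe, ?_, ?_, ?_, hxCD⟩
  · ext u
    simp only [mem_neighborSet, Set.mem_insert_iff, Set.mem_singleton_iff]
    have := huniq u
    grind
  · ext u
    simp only [mem_neighborSet, Set.mem_insert_iff, Set.mem_singleton_iff]
    have := huniq u
    have := hadj u
    have := hvw.symm
    have := K.loopless.irrefl w
    grind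
  · rintro i ⟨hi, hi'⟩ j ⟨hj, hj'⟩ - hij
    simp only [mem_neighborSet, Set.mem_insert_iff, Set.mem_singleton_iff, not_or] at hi hi' hj hj'
    have n1 : ¬ K.Adj v i := fun hh => K.loopless.irrefl i (huniq i hi'.2 hh ▸ hi)
    have n2 : ¬ K.Adj v j := fun hh => K.loopless.irrefl j (huniq j hj'.2 hh ▸ hj)
    have a1 := hEp x i hxw hvx hi n1
    have a2 := hEp x j hxw hvx hj n2
    have a3 := (hEd x hxw hvx).2
    have := tE x i j a3 a1 a2 hi
    grind

end HasTwoNeighbors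

/-! ### Bicliques with an edge in a triangle -/

namespace HasTwoNeighbors

variable {B C D : Set U}

/-- If `z ∉ B` is adjacent to both ends of an edge `pq` of `B`, then `z` lies in both `C` and `D`,
which partition `B`. The part with `p` consists of the neighbours of `z` on the side of `p` and the
non-neighbours of `z` on the side of `q`. -/
theorem crossing [Finite U] (h : K.HasTwoNeighbors B C D) {z p q : U} (hz : z ∉ B) (hp : p ∈ B)
    (hq : q ∈ B) (hpq : K.Adj p q) (hpz : K.Adj p z) (hqz : K.Adj q z) :
    z ∈ C ∧ z ∈ D ∧ (∀ b ∈ B, b ∈ C ↔ b ∉ D) ∧ (p ∈ C ↔ q ∈ D) ∧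
      ∀ b ∈ B, (b ∈ C ↔ p ∈ C) ↔ (K.Adj b q ↔ K.Adj b z) := by
  have hBx := fun a b c => h.isB.1.adj_iff (a := a) (b := b) (c := c)
  have key : ∀ p q : U, p ∈ B → q ∈ B → K.Adj p q → K.Adj p z → K.Adj q z →
      ∃ E, (E = C ∨ E = D) ∧ z ∈ E ∧ ∀ b ∈ B, b ∈ E ↔ (K.Adj b q ↔ K.Adj b z) := by
    intro p q hp hq hpq hpz hqz
    have hcb : K.InducesCompleteBipartite (insert z {b | b ∈ B ∧ (K.Adj b q ↔ K.Adj b z)}) := by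
      refine inducesCompleteBipartite_iff.2 ⟨⟨p, by simp [*], z, by simp, hpz⟩, ?_⟩
      have := K.loopless.irrefl z
      have hs := fun a b => K.adj_comm a b
      rintro a (rfl | ⟨ha, ha'⟩) b (rfl | ⟨hb, hb'⟩) c (rfl | ⟨hc, hc'⟩) hab
      · grind
      · grind
      · grind
      · have := hBx p q b hp hq hb hpq
        have := hBx p q c hp hq hc hpq
        have := hBx b c q hb hc hq
        have := hBx b c p hb hc hp
        have := hBx p b c hp hb hc
        have := hBx q b c hq hb hc
        grind
      · grind
      · have := hBx p q a hp hq ha hpq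
        have := hBx p q c hp hq hc hpq
        have := hBx a c q ha hc hq
        have := hBx a c p ha hc hp
        have := hBx p a c hp ha hc
        have := hBx q a c hq ha hc
        grind
      · have := hBx a b q ha hb hq hab
        grind
      · exact hBx a b c ha hb hc hab
    have hres : ∀ E, K.IsBiclique E → insert z {b | b ∈ B ∧ (K.Adj b q ↔ K.Adj b z)} ⊆ E →
        z ∈ E ∧ ∀ b ∈ B, b ∈ E ↔ (K.Adj b q ↔ K.Adj b z) := by
      intro E hE hsub
      have hzE : z ∈ E := hsub (by simp)
      have hpE : p ∈ E := hsub (by simp [*])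
      refine ⟨hzE, fun b hb => ⟨fun hbE => ?_, fun hb' => hsub (.inr ⟨hb, hb'⟩)⟩⟩
      have := hE.1.adj_iff hpE hzE hbE hpz
      have := hBx p q b hp hq hb hpq
      have hs := fun a b => K.adj_comm a b
      grind
    rcases h.subset_or hcb (b := p) (by simp [*]) hp (z := z) (by simp) hz with hs | hs
    · exact ⟨C, .inl rfl, hres C h.isC hs⟩
    · exact ⟨D, .inr rfl, hres D h.isD hs⟩
  obtain ⟨E, hE, hzE, hbE⟩ := key p q hp hq hpq hpz hqz
  obtain ⟨E', hE', hzE', hbE'⟩ := key q p hq hp hpq.symm hqz hpz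
  have hop : ∀ b ∈ B, (K.Adj b q ↔ ¬ K.Adj b p) := fun b hb => by
    have := hBx p q b hp hq hb hpq
    have hs := fun a b => K.adj_comm a b
    grind
  have := hpq.symm
  have := K.loopless.irrefl p
  have := K.loopless.irrefl q
  grind

/-- Let `bb'` be an edge of `B` with `b ∈ C \ D` and `b' ∈ D \ C`. No induced path on three
vertices that contains it leaves `B`. -/
theorem adj_iff_of_cross [Finite U] (h : K.HasTwoNeighbors B C D) {b b' z : U} (hb : b ∈ B)
    (hbb : K.Adj b b') (hbD : b ∉ D) (hbC' : b' ∉ C) (hz : z ∉ B) :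
    K.Adj b z ↔ K.Adj b' z := by
  constructor
  · intro hbz
    by_contra hn
    have := h.subset_or (inducesCompleteBipartite_path hbb.symm hbz hn) (b := b) (z := z)
      (by simp) hb (by simp) hz
    simp only [Set.insert_subset_iff] at this
    grind
  · intro hbz
    by_contra hn
    have := h.subset_or (inducesCompleteBipartite_path hbb hbz hn) (b := b) (z := z)
      (by simp) hb (by simp) hz
    simp only [Set.insert_subset_iff] at this
    grind

/-- A vertex outside `B` is adjacent to both ends of an edge of `B`, and both parts of `B` have
at least two vertices. -/
theorem few_of_crossing_four [Finite U] (h : K.HasTwoNeighbors B C D) (hK : K.Connected)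
    (htw : ∀ a b, K.neighborSet a = K.neighborSet b → a = b) {z p q x₁ x₂ y₁ y₂ : U}
    (hz : z ∉ B) (hp : p ∈ B) (hq : q ∈ B) (hpq : K.Adj p q) (hpz : K.Adj p z) (hqz : K.Adj q z)
    (hx₁ : x₁ ∈ B) (hx₂ : x₂ ∈ B) (hx : x₁ ≠ x₂) (hxx : ¬ K.Adj x₁ x₂)
    (hy₁ : y₁ ∈ B) (hy₂ : y₂ ∈ B) (hy : y₁ ≠ y₂) (hxy₁ : K.Adj x₁ y₁) (hxy₂ : K.Adj x₁ y₂) :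
    K.HasFewBicliques B C D := by
  have hs := K.adj_comm
  obtain ⟨hzC, hzD, hop, -⟩ := h.crossing hz hp hq hpq hpz hqz
  have hyy : ¬ K.Adj y₁ y₂ := (h.xorB x₁ y₁ y₂ hx₁ hy₁ hy₂ hxy₁).1 hxy₂
  have h21 : K.Adj x₂ y₁ := by
    have := h.xorB x₁ y₁ x₂ hx₁ hy₁ hx₂ hxy₁
    grind
  have h22 : K.Adj x₂ y₂ := by
    have := h.xorB x₁ y₂ x₂ hx₁ hy₂ hx₂ hxy₂
    grind
  wlog hxC : x₁ ∈ C generalizing C D with H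
  · exact (H h.swap hzD hzC (fun b hb => by grind) (by grind)).swap
  wlog hyC : y₁ ∈ C generalizing y₁ y₂ with H
  · exact H hy₂ hy₁ hy.symm hxy₂ hxy₁ (by grind) h22 h21 (by
      have := h.eq_of_mem_iff htw y₁ y₂ hy₁ hy₂ hyy
      grind)
  have hx₂D : x₂ ∈ D ∧ x₂ ∉ C := by
    have := h.eq_of_mem_iff htw x₁ x₂ hx₁ hx₂ hxx
    grind
  have hy₂D : y₂ ∈ D ∧ y₂ ∉ C := by
    have := h.eq_of_mem_iff htw y₁ y₂ hy₁ hy₂ hyy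
    grind
  have hB : ∀ b ∈ B, b = x₁ ∨ b = x₂ ∨ b = y₁ ∨ b = y₂ := by
    intro b hb
    have := h.xorB x₁ y₁ b hx₁ hy₁ hb hxy₁
    have := h.xorB x₂ y₁ b hx₂ hy₁ hb h21
    have := h.xorB x₁ y₂ b hx₁ hy₂ hb hxy₂
    have := h.eq_of_mem_iff htw b x₁ hb hx₁
    have := h.eq_of_mem_iff htw b x₂ hb hx₂
    have := h.eq_of_mem_iff htw b y₁ hb hy₁
    have := h.eq_of_mem_iff htw b y₂ hb hy₂
    grind
  have hc1 : ∀ u ∉ B, (K.Adj x₁ u ↔ K.Adj y₂ u) := fun u hu =>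
    h.adj_iff_of_cross hx₁ hxy₂ (by grind) hy₂D.2 hu
  have hc2 : ∀ u ∉ B, (K.Adj y₁ u ↔ K.Adj x₂ u) := fun u hu =>
    h.adj_iff_of_cross hy₁ h21.symm (by grind) hx₂D.2 hu
  have hN : ∀ u ∉ B, K.Adj x₁ u ∨ K.Adj x₂ u → u ∈ C ∧ u ∈ D := by
    intro u hu hor
    have := h.edge x₁ u hx₁ hu
    have := h.edge x₂ u hx₂ hu
    have := h.edge y₁ u hy₁ hu
    have := h.edge y₂ u hy₂ hu
    grind
  have hdis : ∀ u ∉ B, K.Adj x₁ u → ¬ K.Adj x₂ u := by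
    intro u hu h1 h2
    have := hN u hu (.inl h1)
    have := h.xorC x₁ y₁ u
    grind
  have hcomp : ∀ u ∉ B, ∀ t ∉ B, K.Adj x₁ u → (K.Adj u t ↔ K.Adj x₂ t) := by
    intro u hu t ht h1
    have h2 := hN u hu (.inl h1)
    have h3 := hN t ht
    have := hdis u hu h1
    have := h.path x₁ u t hx₁ hu h1
    have := h.xorC x₁ u t hxC h2.1
    have := h.xorC x₁ u y₁ hxC h2.1 hyC h1
    have := h.xorC u t y₁ h2.1
    have := h.xorC y₁ t u hyC
    grind
  have hcomp' : ∀ u ∉ B, ∀ t ∉ B, K.Adj x₂ u → (K.Adj u t ↔ K.Adj x₁ t) := by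
    intro u hu t ht h1
    have h2 := hN u hu (.inr h1)
    have h3 := hN t ht
    have := fun hh => hdis u hu hh h1
    have := h.path x₂ u t hx₂ hu h1
    have := h.xorD x₂ u t hx₂D.1 h2.2
    have := h.xorD x₂ u y₂ hx₂D.1 h2.2 hy₂D.1 h1
    have := h.xorD u t y₂ h2.2
    have := h.xorD y₂ t u hy₂D.1
    grind
  have hall : ∀ u, u ∈ B ∨ K.Adj x₁ u ∨ K.Adj x₂ u := by
    apply hK.mem_of_closed (s := x₁) (.inl hx₁)
    intro a ha b hab
    change b ∈ B ∨ K.Adj x₁ b ∨ K.Adj x₂ b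
    by_cases hb : b ∈ B
    · exact .inl hb
    · by_cases haB : a ∈ B
      · have := hB a haB
        grind
      · have : K.Adj x₁ a ∨ K.Adj x₂ a := ha.resolve_left haB
        grind
  refine ⟨card_le_six_of_cover (S := {u | u ∉ B ∧ K.Adj x₁ u}) (T := {u | u ∉ B ∧ K.Adj x₂ u})
    x₁ x₂ y₁ y₂ ?_ ?_ ?_, ⟨z, hzC, hzD⟩, ?_⟩
  · rintro u ⟨hu, hu'⟩ t ⟨ht, ht'⟩
    apply htw
    ext s
    simp only [mem_neighborSet]
    by_cases hsB : s ∈ B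
    · have := hB s hsB
      grind
    · rw [hcomp u hu s hsB hu', hcomp t ht s hsB ht']
  · rintro u ⟨hu, hu'⟩ t ⟨ht, ht'⟩
    apply htw
    ext s
    simp only [mem_neighborSet]
    by_cases hsB : s ∈ B
    · have := hB s hsB
      grind
    · rw [hcomp' u hu s hsB hu', hcomp' t ht s hsB ht']
  · intro u
    by_cases hu : u ∈ B
    · have := hB u hu
      tauto
    · have := (hall u).resolve_left hu
      simp only [Set.mem_ofPred_eq]
      tauto
  · intro F hF
    by_contra hne
    have hFB : ∀ u ∈ F, u ∉ B := fun u hu huB => hne ⟨u, huB, hu⟩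
    have hFC : F ⊆ C := fun u hu => (hN u (hFB u hu) ((hall u).resolve_left (hFB u hu))).1
    exact hne (hF.eq_of_subset h.isC hFC ▸ h.meetC)

/-- A vertex outside `B` is adjacent to both ends of an edge of `B`, and one part of `B` is a
singleton. -/
theorem few_of_crossing_star [Finite U] (h : K.HasTwoNeighbors B C D) (hK : K.Connected)
    (htw : ∀ a b, K.neighborSet a = K.neighborSet b → a = b) {z x₁ x₂ y : U}
    (hz : z ∉ B) (hx₁z : K.Adj x₁ z) (hyz : K.Adj y z)
    (hx₁ : x₁ ∈ B) (hx₂ : x₂ ∈ B) (hx : x₁ ≠ x₂) (hxx : ¬ K.Adj x₁ x₂)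
    (hy : y ∈ B) (hxy : K.Adj x₁ y) (hyu : ∀ b ∈ B, K.Adj x₁ b → b = y) :
    K.HasFewBicliques B C D := by
  have hs := K.adj_comm
  obtain ⟨hzC, hzD, hop, hcr, -⟩ := h.crossing hz hx₁ hy hxy hx₁z hyz
  have h2y : K.Adj x₂ y := by
    have := h.xorB x₁ y x₂ hx₁ hy hx₂ hxy
    grind
  wlog hxC : x₁ ∈ C generalizing C D with H
  · exact (H h.swap hzD hzC (fun b hb => by grind) (by grind) (by grind)).swap
  have hyD : y ∈ D ∧ y ∉ C := by grind
  have hx₂D : x₂ ∈ D ∧ x₂ ∉ C := by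
    have := h.eq_of_mem_iff htw x₁ x₂ hx₁ hx₂ hxx
    grind
  have hB : ∀ b ∈ B, b = x₁ ∨ b = x₂ ∨ b = y := by
    intro b hb
    have := h.xorB x₁ y b hx₁ hy hb hxy
    have := h.xorB x₂ y b hx₂ hy hb h2y
    have := h.eq_of_mem_iff htw b x₁ hb hx₁
    have := h.eq_of_mem_iff htw b x₂ hb hx₂
    have := hyu b hb
    grind
  have hc1 : ∀ u ∉ B, (K.Adj x₁ u ↔ K.Adj y u) := fun u hu =>
    h.adj_iff_of_cross hx₁ hxy (by grind) hyD.2 hu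
  have hN₁ : ∀ u ∉ B, K.Adj x₁ u → u ∈ C ∧ u ∈ D := by
    intro u hu hor
    have := h.edge x₁ u hx₁ hu
    have := h.edge y u hy hu
    grind
  have hN₂ : ∀ u ∉ B, K.Adj x₂ u → u ∈ D := by
    intro u hu hor
    have := h.edge x₂ u hx₂ hu
    grind
  have hdis : ∀ u ∉ B, K.Adj x₁ u → ¬ K.Adj x₂ u := by
    intro u hu h1 h2
    have := hN₁ u hu h1
    have := h.xorD x₂ y u
    grind
  have hcomp : ∀ u ∉ B, ∀ t ∉ B, K.Adj x₁ u → (K.Adj u t ↔ K.Adj x₂ t) := by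
    intro u hu t ht h1
    have h2 := hN₁ u hu h1
    have h3 := hN₂ t ht
    have := hN₁ t ht
    have := hdis u hu h1
    have := hc1 t ht
    have := h.path y u t hy hu
    have := h.xorC x₁ u t hxC h2.1
    have := h.xorD x₂ y u
    have := h.xorD y u x₂
    have := h.xorD y u t
    have := h.xorD u t x₂
    have := h.xorD x₂ t u
    grind
  have hcomp' : ∀ u ∉ B, ∀ t ∉ B, K.Adj x₂ u → (K.Adj u t ↔ K.Adj x₁ t) := by
    intro u hu t ht h1
    have h2 := hN₂ u hu h1
    have h3 := hN₂ t ht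
    have := hN₁ t ht
    have := fun hh => hdis u hu hh h1
    have := hdis t ht
    have := hc1 t ht
    have := hc1 u hu
    have := h.path x₂ u t hx₂ hu h1
    have := h.xorD x₂ u t hx₂D.1 h2
    have := h.xorD x₂ u y hx₂D.1 h2 hyD.1 h1
    have := h.xorD u t y h2
    have := h.xorD y t u hyD.1
    grind
  have hall : ∀ u, u ∈ B ∨ K.Adj x₁ u ∨ K.Adj x₂ u := by
    apply hK.mem_of_closed (s := x₁) (.inl hx₁)
    intro a ha b hab
    change b ∈ B ∨ K.Adj x₁ b ∨ K.Adj x₂ b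
    by_cases hb : b ∈ B
    · exact .inl hb
    · by_cases haB : a ∈ B
      · have := hB a haB
        grind
      · have : K.Adj x₁ a ∨ K.Adj x₂ a := ha.resolve_left haB
        grind
  refine ⟨card_le_six_of_cover (S := {u | u ∉ B ∧ K.Adj x₁ u}) (T := {u | u ∉ B ∧ K.Adj x₂ u})
    x₁ x₂ y y ?_ ?_ ?_, ⟨z, hzC, hzD⟩, ?_⟩
  · rintro u ⟨hu, hu'⟩ t ⟨ht, ht'⟩
    apply htw
    ext s
    simp only [mem_neighborSet]
    by_cases hsB : s ∈ B
    · have := hB s hsB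
      grind
    · rw [hcomp u hu s hsB hu', hcomp t ht s hsB ht']
  · rintro u ⟨hu, hu'⟩ t ⟨ht, ht'⟩
    apply htw
    ext s
    simp only [mem_neighborSet]
    by_cases hsB : s ∈ B
    · have := hB s hsB
      grind
    · rw [hcomp' u hu s hsB hu', hcomp' t ht s hsB ht']
  · intro u
    by_cases hu : u ∈ B
    · have := hB u hu
      tauto
    · have := (hall u).resolve_left hu
      simp only [Set.mem_ofPred_eq]
      tauto
  · intro F hF
    by_contra hne
    have hFB : ∀ u ∈ F, u ∉ B := fun u hu huB => hne ⟨u, huB, hu⟩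
    have hFD : F ⊆ D := fun u hu => by
      rcases (hall u).resolve_left (hFB u hu) with h1 | h1
      · exact (hN₁ u (hFB u hu) h1).2
      · exact hN₂ u (hFB u hu) h1
    exact hne (hF.eq_of_subset h.isD hFD ▸ h.meetD)

end HasTwoNeighbors

/-! ### Bicliques without an edge in a triangle -/

namespace HasTwoNeighbors

variable {B C D : Set U}

/-- If no vertex outside `B` is adjacent to both ends of an edge of `B`, then an outside neighbour
`z` of `x ∈ B`, its neighbours in `B`, and the part of `B` opposite to `x` lie in a common
biclique. -/
theorem star [Finite U] (h : K.HasTwoNeighbors B C D)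
    (hno : ∀ z ∉ B, ∀ p ∈ B, ∀ q ∈ B, K.Adj p q → K.Adj p z → ¬ K.Adj q z) {x z : U}
    (hx : x ∈ B) (hz : z ∉ B) (hxz : K.Adj x z) :
    (z ∈ C ∧ ∀ b ∈ B, b ∈ C ↔ (K.Adj x b ∨ K.Adj b z)) ∨
      (z ∈ D ∧ ∀ b ∈ B, b ∈ D ↔ (K.Adj x b ∨ K.Adj b z)) := by
  have hs := K.adj_comm
  obtain ⟨y, hy, hxy⟩ := h.isB.1.exists_adj hx
  have hcb : K.InducesCompleteBipartite (insert z {b | b ∈ B ∧ (K.Adj x b ∨ K.Adj b z)}) := by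
    refine inducesCompleteBipartite_iff.2 ⟨⟨x, by simp [*], z, by simp, hxz⟩, ?_⟩
    have := K.loopless.irrefl z
    have hzz := hno z hz
    rintro a (rfl | ⟨ha, ha'⟩) b (rfl | ⟨hb, hb'⟩) c (rfl | ⟨hc, hc'⟩) hab
    · grind
    · grind
    · grind
    · have := hzz b hb x hx
      have := hzz b hb c hc
      have := hzz x hx b hb
      have := hzz x hx c hc
      have := h.xorB x b c hx hb hc
      have := h.xorB x c b hx hc hb
      grind
    · grind
    · have := hzz a ha x hx
      have := hzz a ha c hc
      have := hzz x hx a ha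
      have := hzz x hx c hc
      have := h.xorB x a c hx ha hc
      have := h.xorB x c a hx hc ha
      grind
    · have := hzz a ha b hb hab
      have := hzz x hx a ha
      have := hzz x hx b hb
      have := h.xorB a b x ha hb hx hab
      grind
    · exact h.xorB a b c ha hb hc hab
  have hres : ∀ E, K.IsBiclique E → insert z {b | b ∈ B ∧ (K.Adj x b ∨ K.Adj b z)} ⊆ E →
      z ∈ E ∧ ∀ b ∈ B, b ∈ E ↔ (K.Adj x b ∨ K.Adj b z) := by
    intro E hE hsub
    have hzE : z ∈ E := hsub (by simp)
    have hxE : x ∈ E := hsub (by simp [*])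
    refine ⟨hzE, fun b hb => ⟨fun hbE => ?_, fun hb' => hsub (.inr ⟨hb, hb'⟩)⟩⟩
    have := hE.1.adj_iff hxE hzE hbE hxz
    grind
  rcases h.subset_or hcb (b := x) (by simp [*]) hx (z := z) (by simp) hz with hs | hs
  · exact .inl (hres C h.isC hs)
  · exact .inr (hres D h.isD hs)

/-- Vertices in one part of `B` have distinct neighbourhoods, which differ outside `B`. -/
theorem exists_outside [Finite U] (h : K.HasTwoNeighbors B C D)
    (htw : ∀ a b, K.neighborSet a = K.neighborSet b → a = b) {p q : U} (hp : p ∈ B) (hq : q ∈ B)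
    (hpq : ¬ K.Adj p q) (hne : p ≠ q) :
    ∃ z ∉ B, (K.Adj p z ∧ ¬ K.Adj q z) ∨ (K.Adj q z ∧ ¬ K.Adj p z) := by
  by_contra! hcon
  refine hne (htw p q ?_)
  ext z
  simp only [mem_neighborSet]
  by_cases hz : z ∈ B
  · have := h.xorB p z q hp hz hq
    have := h.xorB q z p hq hz hp
    have hs := K.adj_comm
    grind
  · have := hcon z hz
    tauto

set_option maxHeartbeats 400000 in
/-- No vertex outside `B` is adjacent to both ends of an edge of `B`, and both parts of `B` have
at least two vertices: the graph is a four-cycle with two pendant vertices at adjacent vertices of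
the cycle. -/
theorem few_of_four [Finite U] (h : K.HasTwoNeighbors B C D) (hK : K.Connected)
    (htw : ∀ a b, K.neighborSet a = K.neighborSet b → a = b)
    (hno : ∀ z ∉ B, ∀ p ∈ B, ∀ q ∈ B, K.Adj p q → K.Adj p z → ¬ K.Adj q z) {x₁ x₂ y₁ y₂ : U}
    (hx₁ : x₁ ∈ B) (hx₂ : x₂ ∈ B) (hx : x₁ ≠ x₂) (hxx : ¬ K.Adj x₁ x₂)
    (hy₁ : y₁ ∈ B) (hy₂ : y₂ ∈ B) (hy : y₁ ≠ y₂) (hxy₁ : K.Adj x₁ y₁) (hxy₂ : K.Adj x₁ y₂) :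
    K.HasFewBicliques B C D := by
  have hs := K.adj_comm
  have hyy : ¬ K.Adj y₁ y₂ := (h.xorB x₁ y₁ y₂ hx₁ hy₁ hy₂ hxy₁).1 hxy₂
  have h21 : K.Adj x₂ y₁ := by
    have := h.xorB x₁ y₁ x₂ hx₁ hy₁ hx₂ hxy₁
    grind
  have h22 : K.Adj x₂ y₂ := by
    have := h.xorB x₁ y₂ x₂ hx₁ hy₂ hx₂ hxy₂
    grind
  obtain ⟨z, hz, hz'⟩ := h.exists_outside htw hx₁ hx₂ hxx hx
  wlog hzx : K.Adj x₁ z ∧ ¬ K.Adj x₂ z generalizing x₁ x₂ with H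
  · exact H hx₂ hx₁ hx.symm (fun hh => hxx hh.symm) h21 h22 hxy₁ hxy₂ hz'.symm
      (hz'.resolve_left hzx)
  obtain ⟨z', hzB', hz''⟩ := h.exists_outside htw hy₁ hy₂ hyy hy
  wlog hzy : K.Adj y₁ z' ∧ ¬ K.Adj y₂ z' generalizing y₁ y₂ with H
  · exact H hy₂ hy₁ hy.symm (fun hh => hyy hh.symm) hxy₂ hxy₁ h22 h21 hz''.symm
      (hz''.resolve_left hzy)
  have s1 := h.star hno hx₁ hz hzx.1
  wlog hzC : z ∈ C ∧ ∀ b ∈ B, b ∈ C ↔ (K.Adj x₁ b ∨ K.Adj b z) generalizing C D with H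
  · exact (H h.swap s1.symm (s1.resolve_left hzC)).swap
  obtain ⟨-, hC⟩ := hzC
  have hx₂C : x₂ ∉ C := by
    have := hC x₂ hx₂
    grind
  have hD : ∀ b ∈ B, b ∈ D ↔ (K.Adj y₁ b ∨ K.Adj b z') := by
    refine ((h.star hno hy₁ hzB' hzy.1).resolve_left fun hh => hx₂C ?_).2
    exact (hh.2 x₂ hx₂).2 (.inl h21.symm)
  have hx₁C : x₁ ∈ C := (hC x₁ hx₁).2 (.inr hzx.1)
  have hy₁C : y₁ ∈ C := (hC y₁ hy₁).2 (.inl hxy₁)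
  have hy₂C : y₂ ∈ C := (hC y₂ hy₂).2 (.inl hxy₂)
  have hx₁D : x₁ ∈ D := (hD x₁ hx₁).2 (.inl hxy₁.symm)
  have hx₂D : x₂ ∈ D := (hD x₂ hx₂).2 (.inl h21.symm)
  have hy₁D : y₁ ∈ D := (hD y₁ hy₁).2 (.inr hzy.1)
  have hy₂D : y₂ ∉ D := by
    have := hD y₂ hy₂
    grind
  have hB : ∀ b ∈ B, b = x₁ ∨ b = x₂ ∨ b = y₁ ∨ b = y₂ := by
    intro b hb
    have := h.xorB x₁ y₁ b hx₁ hy₁ hb hxy₁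
    have := h.xorB x₂ y₁ b hx₂ hy₁ hb h21
    have := h.xorB x₁ y₂ b hx₁ hy₂ hb hxy₂
    have := h.eq_of_mem_iff htw b x₁ hb hx₁
    have := h.eq_of_mem_iff htw b x₂ hb hx₂
    have := h.eq_of_mem_iff htw b y₁ hb hy₁
    have := h.eq_of_mem_iff htw b y₂ hb hy₂
    have := hC b hb
    have := hD b hb
    grind
  -- An outside neighbour of `x₂` would lie in a third biclique, and likewise for `y₂`.
  have hcorner : ∀ u ∉ B, ¬ K.Adj x₂ u ∧ ¬ K.Adj y₂ u := by
    intro u hu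
    constructor
    · intro hux
      have h1 := hno u hu x₂ hx₂ y₂ hy₂ h22 hux
      have := h.subset_or (inducesCompleteBipartite_path h22.symm hux h1) (b := x₂) (z := u)
        (by simp) hx₂ (by simp) hu
      simp only [Set.insert_subset_iff] at this
      grind
    · intro huy
      have h1 := hno u hu y₂ hy₂ x₂ hx₂ h22.symm huy
      have := h.subset_or (inducesCompleteBipartite_path h22 huy h1) (b := y₂) (z := u)
        (by simp) hy₂ (by simp) hu
      simp only [Set.insert_subset_iff] at this
      grind
  have hZ : ∀ u ∉ B, ∀ t ∉ B, K.Adj x₁ u → ¬ K.Adj u t := by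
    intro u hu t ht hxu hut
    have hor : ∀ s ∉ B, K.Adj x₁ s → s ∈ C := by
      intro s hsB hxs
      have h1 := hno s hsB x₁ hx₁ y₂ hy₂ hxy₂ hxs
      have := h.subset_or (inducesCompleteBipartite_path hxy₂.symm hxs h1) (b := x₁) (z := s)
        (by simp) hx₁ (by simp) hsB
      simp only [Set.insert_subset_iff] at this
      grind
    have := hor u hu hxu
    have := hor t ht
    have := h.path x₁ u t hx₁ hu hxu hut
    have := h.xorC x₁ u t
    have := h.xorC x₁ u y₂
    have := h.xorC u t y₂
    have := h.xorD x₁ u x₂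
    have := hcorner u hu
    have := hcorner t ht
    grind
  have hZ' : ∀ u ∉ B, ∀ t ∉ B, K.Adj y₁ u → ¬ K.Adj u t := by
    intro u hu t ht hyu hut
    have hor : ∀ s ∉ B, K.Adj y₁ s → s ∈ D := by
      intro s hsB hys
      have h1 := hno s hsB y₁ hy₁ x₂ hx₂ h21.symm hys
      have := h.subset_or (inducesCompleteBipartite_path h21 hys h1) (b := y₁) (z := s)
        (by simp) hy₁ (by simp) hsB
      simp only [Set.insert_subset_iff] at this
      grind
    have := hor u hu hyu
    have := hor t ht
    have := h.path y₁ u t hy₁ hu hyu hut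
    have := h.xorD y₁ u t
    have := h.xorD y₁ u x₂
    have := h.xorD u t x₂
    have := h.xorC y₁ u y₂
    have := hcorner u hu
    have := hcorner t ht
    grind
  have hall : ∀ u, u ∈ B ∨ K.Adj x₁ u ∨ K.Adj y₁ u := by
    apply hK.mem_of_closed (s := x₁) (.inl hx₁)
    intro a ha b hab
    change b ∈ B ∨ K.Adj x₁ b ∨ K.Adj y₁ b
    by_cases hb : b ∈ B
    · exact .inl hb
    · by_cases haB : a ∈ B
      · have := hB a haB
        have := hcorner b hb
        grind
      · have h1 : K.Adj x₁ a ∨ K.Adj y₁ a := ha.resolve_left haB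
        have := hZ a haB b hb
        have := hZ' a haB b hb
        tauto
  refine ⟨card_le_six_of_cover (S := {u | u ∉ B ∧ K.Adj x₁ u}) (T := {u | u ∉ B ∧ K.Adj y₁ u})
    x₁ x₂ y₁ y₂ ?_ ?_ ?_, ⟨x₁, hx₁C, hx₁D⟩, meetB_of_edges ?_⟩
  · rintro u ⟨hu, hu'⟩ t ⟨ht, ht'⟩
    apply htw
    ext s
    simp only [mem_neighborSet]
    by_cases hsB : s ∈ B
    · have := hB s hsB
      have := hcorner u hu
      have := hcorner t ht
      have := hno u hu x₁ hx₁ y₁ hy₁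
      have := hno t ht x₁ hx₁ y₁ hy₁
      grind
    · have := hZ u hu s hsB hu'
      have := hZ t ht s hsB ht'
      tauto
  · rintro u ⟨hu, hu'⟩ t ⟨ht, ht'⟩
    apply htw
    ext s
    simp only [mem_neighborSet]
    by_cases hsB : s ∈ B
    · have := hB s hsB
      have := hcorner u hu
      have := hcorner t ht
      have := hno u hu x₁ hx₁ y₁ hy₁
      have := hno t ht x₁ hx₁ y₁ hy₁
      grind
    · have := hZ' u hu s hsB hu'
      have := hZ' t ht s hsB ht'
      tauto
  · intro u
    by_cases hu : u ∈ B
    · have := hB u hu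
      tauto
    · have := (hall u).resolve_left hu
      simp only [Set.mem_ofPred_eq]
      tauto
  · intro a b hab
    by_contra! hcon
    have := hZ a hcon.1 b hcon.2
    have := hZ' a hcon.1 b hcon.2
    have := hall a
    tauto

/-- `B` is a star with centre `y`, no vertex outside `B` is adjacent to both ends of an edge of
`B`, and two leaves of the star have neighbours outside `B`. -/
theorem few_of_star [Finite U] (h : K.HasTwoNeighbors B C D) (hK : K.Connected)
    (htw : ∀ a b, K.neighborSet a = K.neighborSet b → a = b)
    (hno : ∀ z ∉ B, ∀ p ∈ B, ∀ q ∈ B, K.Adj p q → K.Adj p z → ¬ K.Adj q z) {x₁ x₂ y z₁ z₂ : U}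
    (hx₁ : x₁ ∈ B) (hx₂ : x₂ ∈ B) (hx : x₁ ≠ x₂) (hy : y ∈ B)
    (hyB : ∀ b ∈ B, b ≠ y → K.Adj y b) (hyN : ∀ u, K.Adj y u → u ∈ B)
    (hyx₁ : K.Adj y x₁) (hyx₂ : K.Adj y x₂)
    (hz₁ : z₁ ∉ B) (hz₂ : z₂ ∉ B) (hxz₁ : K.Adj x₁ z₁) (hxz₂ : K.Adj x₂ z₂) :
    K.HasFewBicliques B C D := by
  have hs := K.adj_comm
  have hind : ∀ b ∈ B, ∀ c ∈ B, K.Adj y b → K.Adj y c → ¬ K.Adj b c := fun b hb c hc hyb hyc =>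
    (h.xorB y b c hy hb hc hyb).1 hyc
  wlog hdist : ∃ z ∉ B, K.Adj x₁ z ∧ ¬ K.Adj x₂ z generalizing x₁ x₂ z₁ z₂ with H
  · obtain ⟨z, hz, hz'⟩ := h.exists_outside htw hx₁ hx₂ (hind x₁ hx₁ x₂ hx₂ hyx₁ hyx₂) hx
    refine H hx₂ hx₁ hx.symm hyx₂ hyx₁ hz₂ hz₁ hxz₂ hxz₁ ⟨z, hz, hz'.resolve_left fun hh => ?_⟩
    exact hdist ⟨z, hz, hh⟩
  clear hz₁ hxz₁
  obtain ⟨z, hz, hxz, hxz'⟩ := hdist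
  have hyu : ∀ u ∉ B, ¬ K.Adj u y := fun u hu hh => hu (hyN u hh.symm)
  -- The trace on `B` of an outside vertex with a neighbour in `B` is that of `C` or that of `D`.
  have hor : ∀ u ∉ B, ∀ x ∈ B, K.Adj x u →
      (u ∈ C ∧ y ∈ C ∧ ∀ b ∈ B, K.Adj y b → (b ∈ C ↔ K.Adj b u)) ∨
      (u ∈ D ∧ y ∈ D ∧ ∀ b ∈ B, K.Adj y b → (b ∈ D ↔ K.Adj b u)) := by
    intro u hu x hxB hxu
    have hyx : K.Adj y x := hyB x hxB (by rintro rfl; exact hu (hyN u hxu))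
    refine (h.star hno hxB hu hxu).imp ?_ ?_
    · rintro ⟨h1, h2⟩
      refine ⟨h1, (h2 y hy).2 (.inl hyx.symm), fun b hb hyb => ?_⟩
      have := hind x hxB b hb hyx hyb
      have := h2 b hb
      tauto
    · rintro ⟨h1, h2⟩
      refine ⟨h1, (h2 y hy).2 (.inl hyx.symm), fun b hb hyb => ?_⟩
      have := hind x hxB b hb hyx hyb
      have := h2 b hb
      tauto
  have s1 := hor z hz x₁ hx₁ hxz
  wlog hzC : z ∈ C ∧ y ∈ C ∧ ∀ b ∈ B, K.Adj y b → (b ∈ C ↔ K.Adj b z) generalizing C D with H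
  · exact (H h.swap (fun u hu x hx hxu => (hor u hu x hx hxu).symm) s1.symm
      (s1.resolve_left hzC)).swap
  obtain ⟨hzC, hyC, hzCB⟩ := hzC
  have hx₁C : x₁ ∈ C := (hzCB x₁ hx₁ hyx₁).2 hxz
  have hx₂C : x₂ ∉ C := fun hh => hxz' ((hzCB x₂ hx₂ hyx₂).1 hh)
  obtain ⟨hzD, hyD, hzDB⟩ := (hor z₂ hz₂ x₂ hx₂ hxz₂).resolve_left fun hh =>
    hx₂C ((hh.2.2 x₂ hx₂ hyx₂).2 hxz₂)
  have hx₂D : x₂ ∈ D := (hzDB x₂ hx₂ hyx₂).2 hxz₂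
  have hNC : ∀ u ∉ B, (∀ b ∈ B, K.Adj y b → (b ∈ C ↔ K.Adj b u)) → ∀ t ∉ B, ¬ K.Adj u t := by
    intro u hu hub t ht hut
    have e1 : K.Adj x₁ u := (hub x₁ hx₁ hyx₁).1 hx₁C
    have e2 : ¬ K.Adj x₂ u := fun hh => hx₂C ((hub x₂ hx₂ hyx₂).2 hh)
    have e3 : u ∉ D := by
      intro huD
      have := h.xorD y x₂ u hyD hx₂D huD hyx₂
      have := hyu u hu
      grind
    have e4 : u ∈ C := by
      rcases h.edge x₁ u hx₁ hu e1 with hh | hh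
      exacts [hh.2, absurd hh.2 e3]
    by_cases e5 : K.Adj x₁ t
    · rcases hor t ht x₁ hx₁ e5 with hh | hh
      · exact (h.xorC x₁ u t hx₁C e4 hh.1 e1).1 e5 hut
      · have e6 : K.Adj x₂ t := (hh.2.2 x₂ hx₂ hyx₂).1 hx₂D
        have := h.path x₂ t u hx₂ ht e6 hut.symm e2
        tauto
    · have e6 := (h.path x₁ u t hx₁ hu e1 hut e5).resolve_right fun hh => e3 hh.2.1
      have := h.xorC x₁ u y hx₁C e4 hyC e1
      have := h.xorC u t y e4 e6.2.2 hyC hut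
      have := hyu u hu
      have := hyu t ht
      have := hyx₁.symm
      tauto
  have hND : ∀ u ∉ B, u ∈ D → (∀ b ∈ B, K.Adj y b → (b ∈ D ↔ K.Adj b u)) →
      ∀ t ∉ B, ¬ K.Adj u t := by
    intro u hu huD hub t ht hut
    have e1 : K.Adj x₂ u := (hub x₂ hx₂ hyx₂).1 hx₂D
    by_cases e5 : K.Adj x₂ t
    · have hh := (hor t ht x₂ hx₂ e5).resolve_left fun hh => hx₂C ((hh.2.2 x₂ hx₂ hyx₂).2 e5)
      exact (h.xorD x₂ u t hx₂D huD hh.1 e1).1 e5 hut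
    · have e6 := (h.path x₂ u t hx₂ hu e1 hut e5).resolve_left fun hh => hx₂C hh.1
      have := h.xorD x₂ u y hx₂D huD hyD e1
      have := h.xorD u t y huD e6.2.2 hyD hut
      have := hyu u hu
      have := hyu t ht
      have := hyx₂.symm
      tauto
  have hN : ∀ u ∉ B, ∀ x ∈ B, K.Adj x u → ∀ t ∉ B, ¬ K.Adj u t := by
    intro u hu x hx hxu
    rcases hor u hu x hx hxu with hh | hh
    · exact hNC u hu hh.2.2
    · exact hND u hu hh.1 hh.2.2
  have hall : ∀ u, u ∈ B ∨ ∃ x ∈ B, K.Adj x u := by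
    apply hK.mem_of_closed (s := y) (.inl hy)
    intro a ha b hab
    change b ∈ B ∨ ∃ x ∈ B, K.Adj x b
    by_cases hb : b ∈ B
    · exact .inl hb
    · by_cases haB : a ∈ B
      · exact .inr ⟨a, haB, hab⟩
      · obtain ⟨x, hx, hxa⟩ := ha.resolve_left haB
        exact absurd hab (hN a haB x hx hxa b hb)
  -- Two outside vertices with the same trace on `B` are false twins.
  have htrace : ∀ u ∉ B, ∀ t ∉ B, (∀ b ∈ B, K.Adj y b → (K.Adj b u ↔ K.Adj b t)) → u = t := by
    intro u hu t ht hut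
    obtain ⟨x, hx, hxu⟩ := (hall u).resolve_left hu
    obtain ⟨x', hx', hxt⟩ := (hall t).resolve_left ht
    apply htw
    ext s
    simp only [mem_neighborSet]
    by_cases hsB : s ∈ B
    · by_cases hsy : s = y
      · subst hsy
        have := hyu u hu
        have := hyu t ht
        tauto
      · rw [K.adj_comm u, K.adj_comm t]
        exact hut s hsB (hyB s hsB hsy)
    · have := hN u hu x hx hxu s hsB
      have := hN t ht x' hx' hxt s hsB
      tauto
  -- A leaf of the star that lies in both `C` and `D` forces the trace of `C` into that of `D`.
  have hCD : ∀ c ∈ B, K.Adj y c → c ∈ C → c ∈ D → ∀ b ∈ B, K.Adj y b → b ∈ C → b ∈ D := by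
    intro c hc hyc hcC hcD b hb hyb hbC
    have e1 := (hzCB c hc hyc).1 hcC
    have e2 := (hzDB c hc hyc).1 hcD
    have e3 := hNC z hz hzCB z₂ hz₂
    have := h.subset_or (inducesCompleteBipartite_path e1.symm e2 e3) (b := c) (z := z₂)
        (by simp) hc (by simp) hz₂
    simp only [Set.insert_subset_iff, Set.singleton_subset_iff] at this
    rcases this with hh | hh
    · have e4 := h.xorC y b z₂ hyC hbC hh.2.2 hyb
      have := hyu z₂ hz₂
      have := hzDB b hb hyb
      grind
    · have e4 := h.xorD y x₂ z hyD hx₂D hh.1 hyx₂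
      have := hyu z hz
      grind
  have hxC : ∀ b ∈ B, K.Adj y b → b ∈ C → b = x₁ := by
    intro b hb hyb hbC
    exact h.eq_of_mem_iff htw b x₁ hb hx₁ (hind b hb x₁ hx₁ hyb hyx₁) (by tauto)
      ⟨fun hh => hCD b hb hyb hbC hh x₁ hx₁ hyx₁ hx₁C,
        fun hh => hCD x₁ hx₁ hyx₁ hx₁C hh b hb hyb hbC⟩
  refine ⟨card_le_six_of_cover (S := {z₂}) (T := {u | u ∈ B ∧ K.Adj y u ∧ u ∉ C ∧ u ∉ D})
    x₁ x₂ y z ?_ ?_ ?_, ⟨y, hyC, hyD⟩, meetB_of_edges ?_⟩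
  · exact Set.subsingleton_singleton
  · rintro u ⟨hu, hu', hu''⟩ t ⟨ht, ht', ht''⟩
    exact h.eq_of_mem_iff htw u t hu ht (hind u hu t ht hu' ht') (by tauto) (by tauto)
  · intro u
    by_cases hu : u ∈ B
    · by_cases huy : u = y
      · tauto
      · have e1 := hyB u hu huy
        have := hxC u hu e1
        have := h.eq_of_mem_iff htw u x₂ hu hx₂ (hind u hu x₂ hx₂ e1 hyx₂)
        simp only [Set.mem_ofPred_eq]
        tauto
    · obtain ⟨x, hx, hxu⟩ := (hall u).resolve_left hu
      rcases hor u hu x hx hxu with hh | hh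
      · have := htrace u hu z hz fun b hb hyb => by rw [← hh.2.2 b hb hyb, hzCB b hb hyb]
        tauto
      · have := htrace u hu z₂ hz₂ fun b hb hyb => by rw [← hh.2.2 b hb hyb, hzDB b hb hyb]
        simp only [Set.mem_singleton_iff]
        tauto
  · intro a b hab
    by_contra! hcon
    obtain ⟨x, hx, hxa⟩ := (hall a).resolve_left hcon.1
    exact hN a hcon.1 x hx hxa b hcon.2 hab

/-- Structure of a graph without false twins around a biclique `B` with exactly two neighbours in
the biclique graph. -/
theorem structure_or [Finite U] (h : K.HasTwoNeighbors B C D) (hK : K.Connected)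
    (htw : ∀ a b, K.neighborSet a = K.neighborSet b → a = b) :
    (∃ a b c : U, a ≠ c ∧ B = {b} ∪ {a, c} ∧ K.neighborSet a = {b} ∧
      K.neighborSet b = {a, c}) ∨
    (∃ v w x : U, v ≠ w ∧ v ≠ x ∧ w ≠ x ∧ B = {v, w} ∧ K.neighborSet v = {w, x} ∧
      K.neighborSet w = {v, x} ∧ K.IsIndepSet (K.neighborSet x \ {v, w}) ∧
      (K.neighborSet x \ {v, w}).Nonempty) ∨
    K.HasFewBicliques B C D := by
  have hs := K.adj_comm
  by_cases hB : ∀ p ∈ B, ∀ q ∈ B, ¬ K.Adj p q → p = q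
  · obtain ⟨v, w, x, hvw, hvx, hwx, hBe, hv, hw, hind, hxCD⟩ := h.triangle htw hB
    by_cases hI : (K.neighborSet x \ {v, w}).Nonempty
    · exact .inr (.inl ⟨v, w, x, hvw, hvx, hwx, hBe, hv, hw, hind, hI⟩)
    · right; right
      have hx : ∀ u, K.Adj x u → u = v ∨ u = w := by
        intro u hu
        by_contra hne
        exact hI ⟨u, hu, by simpa using hne⟩
      have hv' : ∀ u, K.Adj v u ↔ u = w ∨ u = x := fun u => by
        simpa using Set.ext_iff.1 hv u
      have hw' : ∀ u, K.Adj w u ↔ u = v ∨ u = x := fun u => by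
        simpa using Set.ext_iff.1 hw u
      have hB' : ∀ u, u ∈ B ↔ u = v ∨ u = w := by simp [hBe]
      have hall : ∀ u, u ∈ ({v, w, x} : Set U) := by
        apply hK.mem_of_closed (s := v) (by simp)
        rintro a (rfl | rfl | rfl) b hab
        · have := (hv' b).1 hab
          simp; tauto
        · have := (hw' b).1 hab
          simp; tauto
        · have := hx b hab
          simp; tauto
      refine ⟨card_le_six_of_cover (S := ∅) (T := ∅) v w x x (by simp) (by simp) fun u => ?_,
        ⟨x, hxCD⟩, meetB_of_edges fun a b hab => ?_⟩
      · have := hall u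
        simp only [Set.mem_insert_iff, Set.mem_singleton_iff] at this
        tauto
      · have ha := hall a
        have hb := hall b
        have := hab.ne
        simp only [Set.mem_insert_iff, Set.mem_singleton_iff] at ha hb
        grind
  push Not at hB
  obtain ⟨x₁, hx₁, x₂, hx₂, hxx, hx⟩ := hB
  obtain ⟨y, hy, hxy⟩ := h.isB.1.exists_adj hx₁
  have h2y : K.Adj x₂ y := by
    have := h.xorB x₁ y x₂ hx₁ hy hx₂ hxy
    grind
  by_cases hno : ∀ z ∉ B, ∀ p ∈ B, ∀ q ∈ B, K.Adj p q → K.Adj p z → ¬ K.Adj q z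
  · by_cases hyu : ∀ b ∈ B, K.Adj x₁ b → b = y
    · have hyB : ∀ b ∈ B, b ≠ y → K.Adj y b := by
        intro b hb hby
        have := h.xorB x₁ y b hx₁ hy hb hxy
        have := hyu b hb
        grind
      have hyN : ∀ u, K.Adj y u → u ∈ B := by
        intro u hyu'
        by_contra hu
        refine hu ((isBiclique_iff.1 h.isB).2 u ?_)
        refine inducesCompleteBipartite_iff.2 ⟨⟨x₁, by simp [*], y, by simp [*], hxy⟩, ?_⟩
        have huB : ∀ b ∈ B, K.Adj u b → b = y := by
          intro b hb hub
          by_contra hby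
          exact hno u hu y hy b hb (hyB b hb hby) hyu' hub.symm
        have := K.loopless.irrefl u
        rintro a (rfl | ha) b (rfl | hb) c (rfl | hc) hab
        · grind
        · grind
        · grind
        · have := h.xorB b c y hb hc hy
          have := huB b hb
          have := huB c hc
          have := hyB c hc
          grind
        · grind
        · have := huB a ha hab.symm
          have := huB c hc
          have := hyB c hc
          grind
        · have := h.xorB a b y ha hb hy
          have := huB a ha
          have := huB b hb
          have := hyB a ha
          have := hyB b hb
          grind
        · exact h.xorB a b c ha hb hc hab
      by_cases htwo : ∃ c₁ ∈ B, ∃ c₂ ∈ B, c₁ ≠ c₂ ∧ (∃ z ∉ B, K.Adj c₁ z) ∧ ∃ z ∉ B, K.Adj c₂ z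
      · obtain ⟨c₁, h1, c₂, h2, hne, ⟨z₁, hz₁, hcz₁⟩, z₂, hz₂, hcz₂⟩ := htwo
        have n1 : c₁ ≠ y := by rintro rfl; exact hz₁ (hyN z₁ hcz₁)
        have n2 : c₂ ≠ y := by rintro rfl; exact hz₂ (hyN z₂ hcz₂)
        exact .inr (.inr (h.few_of_star hK htw hno h1 h2 hne hy hyB hyN (hyB c₁ h1 n1)
          (hyB c₂ h2 n2) hz₁ hz₂ hcz₁ hcz₂))
      · left
        have hleaf : ∀ a ∈ B, a ≠ y → (∀ z ∉ B, ¬ K.Adj a z) → K.neighborSet a = {y} := by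
          intro a ha hay haz
          ext u
          simp only [mem_neighborSet, Set.mem_singleton_iff]
          constructor
          · intro hau
            by_contra huy
            have hu : u ∈ B := by_contra fun hu => haz u hu hau
            exact (h.xorB y a u hy ha hu (hyB a ha hay)).1 (hyB u hu huy) hau
          · rintro rfl
            exact (hyB a ha hay).symm
        wlog hout : ∀ z ∉ B, ¬ K.Adj x₁ z generalizing x₁ x₂ with H
        · refine H x₂ hx₂ x₁ hx₁ (fun hh => hxx hh.symm) hx.symm h2y hxy ?_ ?_
          · intro b hb h2b
            by_contra hby
            exact (h.xorB y x₂ b hy hx₂ hb h2y.symm).1 (hyB b hb hby) h2b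
          · intro z hz hxz
            push Not at hout
            exact htwo ⟨x₁, hx₁, x₂, hx₂, hx, hout, z, hz, hxz⟩
        have l1 := hleaf x₁ hx₁ hxy.ne hout
        have hBe : ∀ b, b ∈ B ↔ b = y ∨ b = x₁ ∨ b = x₂ := by
          refine fun b => ⟨fun hb => ?_, by rintro (rfl | rfl | rfl) <;> assumption⟩
          by_contra! hcon
          by_cases h1 : ∀ z ∉ B, ¬ K.Adj b z
          · exact hcon.2.1 (htw b x₁ (by rw [l1, hleaf b hb hcon.1 h1]))
          · by_cases h2 : ∀ z ∉ B, ¬ K.Adj x₂ z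
            · exact hx (htw x₁ x₂ (by rw [l1, hleaf x₂ hx₂ h2y.ne h2]))
            · push Not at h1 h2
              exact htwo ⟨b, hb, x₂, hx₂, hcon.2.2, h1, h2⟩
        refine ⟨x₁, y, x₂, hx, ?_, l1, ?_⟩
        · ext b
          simp only [hBe b, Set.mem_union, Set.mem_insert_iff, Set.mem_singleton_iff]
        · ext b
          have := hBe b
          have := hyN b
          have := K.loopless.irrefl y
          simp only [mem_neighborSet, Set.mem_insert_iff, Set.mem_singleton_iff]
          grind
    · push Not at hyu
      obtain ⟨y', hy', hxy', hne⟩ := hyu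
      exact .inr (.inr (h.few_of_four hK htw hno hx₁ hx₂ hx hxx hy hy' hne.symm hxy hxy'))
  · right; right
    push Not at hno
    obtain ⟨z, hz, p, hp, q, hq, hpq, hpz, hqz⟩ := hno
    by_cases hyu : ∀ b ∈ B, K.Adj x₁ b → b = y
    · -- The edge `pq` has one end `y`, and the other end is `x₁` or `x₂`.
      obtain ⟨-, -, hop, -⟩ := h.crossing hz hp hq hpq hpz hqz
      have hyB : ∀ b ∈ B, b ≠ y → b = x₁ ∨ b = x₂ := by
        intro b hb hby
        have := h.xorB x₁ y b hx₁ hy hb hxy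
        have := h.xorB x₂ y b hx₂ hy hb h2y
        have := hyu b hb
        have := hop b hb
        have := hop x₁ hx₁
        have := hop x₂ hx₂
        have := h.eq_of_mem_iff htw b x₁ hb hx₁
        have := h.eq_of_mem_iff htw b x₂ hb hx₂
        have := h.eq_of_mem_iff htw x₁ x₂ hx₁ hx₂
        grind
      have hyz : K.Adj y z := by
        by_contra hn
        have e1 := hyB p hp (by rintro rfl; exact hn hpz)
        have e2 := hyB q hq (by rintro rfl; exact hn hqz)
        rcases e1 with rfl | rfl <;> rcases e2 with rfl | rfl
        exacts [hpq.ne rfl, hxx hpq, hxx hpq.symm, hpq.ne rfl]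
      have hxz : K.Adj x₁ z ∨ K.Adj x₂ z := by
        by_cases hpy : p = y
        · have := hyB q hq fun hqy => hpq.ne (hpy.trans hqy.symm)
          rcases this with rfl | rfl <;> tauto
        · rcases hyB p hp hpy with rfl | rfl <;> tauto
      rcases hxz with hxz | hxz
      · exact h.few_of_crossing_star hK htw hz hxz hyz hx₁ hx₂ hx hxx hy hxy hyu
      · refine h.few_of_crossing_star hK htw hz hxz hyz hx₂ hx₁ hx.symm (fun hh => hxx hh.symm) hy
          h2y fun b hb h2b => ?_
        have := h.xorB x₂ b x₁ hx₂ hb hx₁ h2b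
        have := hyu b hb
        grind
    · push Not at hyu
      obtain ⟨y', hy', hxy', hne⟩ := hyu
      exact h.few_of_crossing_four hK htw hz hp hq hpq hpz hqz hx₁ hx₂ hx hxx hy hy' hne.symm
        hxy hxy'

end HasTwoNeighbors

/-! ### Isomorphisms of biclique graphs, false twins and pendant vertices -/

/-- `F` is a biclique of the subgraph of `K` induced by `X`, expressed by sets of vertices of
`K`. -/
structure IsBicliqueOn (K : SimpleGraph U) (X F : Set U) : Prop where
  subset : F ⊆ X
  induces : K.InducesCompleteBipartite F
  mem : ∀ u ∈ X, K.InducesCompleteBipartite (insert u F) → u ∈ F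

/-- A map that preserves and reflects adjacency on `F` preserves and reflects complete
bipartiteness. -/
theorem inducesCompleteBipartite_image_iff {F : Set U} {π : U → U'}
    (hπ : ∀ a ∈ F, ∀ b ∈ F, K'.Adj (π a) (π b) ↔ K.Adj a b) :
    K'.InducesCompleteBipartite (π '' F) ↔ K.InducesCompleteBipartite F := by
  simp only [inducesCompleteBipartite_iff, Set.forall_mem_image, Set.exists_mem_image]
  refine and_congr ?_ ?_
  · exact exists_congr fun a => and_congr_right fun ha => exists_congr fun b =>
      and_congr_right fun hb => hπ a ha b hb
  · refine forall₂_congr fun a ha => forall₂_congr fun b hb => forall₂_congr fun c hc => ?_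
    rw [hπ a ha b hb, hπ a ha c hc, hπ b hb c hc]

theorem isBiclique_induce_iff {X : Set U} {F : Set X} :
    (K.induce X).IsBiclique F ↔ K.IsBicliqueOn X (Subtype.val '' F) := by
  have key : ∀ E : Set X, K.InducesCompleteBipartite (Subtype.val '' E) ↔
      (K.induce X).InducesCompleteBipartite E := fun E =>
    inducesCompleteBipartite_image_iff fun a _ b _ => Iff.rfl
  rw [isBiclique_iff]
  constructor
  · rintro ⟨h1, h2⟩
    refine ⟨by simp, (key F).2 h1, fun u hu hins => ⟨⟨u, hu⟩, h2 ⟨u, hu⟩ ?_, rfl⟩⟩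
    rwa [← key, Set.image_insert_eq]
  · rintro ⟨-, h1, h2⟩
    refine ⟨(key F).1 h1, fun u hins => ?_⟩
    rw [← key, Set.image_insert_eq] at hins
    obtain ⟨t, ht, htu⟩ := h2 u u.2 hins
    exact Subtype.val_injective htu ▸ ht

theorem IsBicliqueOn.eq_of_subset {X E F : Set U} (hE : K.IsBicliqueOn X E)
    (hF : K.InducesCompleteBipartite F) (hFX : F ⊆ X) (h : E ⊆ F) : E = F := by
  refine h.antisymm fun u hu => hE.mem u (hFX hu) ?_
  obtain ⟨⟨a, ha, b, hb, hab⟩, -⟩ := inducesCompleteBipartite_iff.1 hE.induces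
  exact hF.subset (Set.insert_subset hu h) (.inr ha) (.inr hb) hab

/-- A bijection, given by `f`, between the bicliques of `K` that satisfy `p` and the bicliques of
`K'.induce X`, such that `f` preserves and reflects intersection, is an isomorphism of
intersection graphs. -/
theorem exists_bicliqueGraph_iso {p : Set U → Prop} {X : Set U'} (f : Set U → Set U')
    (hf : ∀ F, K.IsBiclique F → p F → K'.IsBicliqueOn X (f F))
    (hsurj : ∀ F', K'.IsBicliqueOn X F' → ∃ F, K.IsBiclique F ∧ p F ∧ f F = F')
    (hinj : ∀ F E, K.IsBiclique F → p F → K.IsBiclique E → p E → f F = f E → F ⊆ E)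
    (hmeet : ∀ F E, K.IsBiclique F → p F → K.IsBiclique E → p E →
      ((f F ∩ f E).Nonempty ↔ (F ∩ E).Nonempty)) :
    ∃ φ : K.bicliqueGraph.induce {F | p F.1} ≃g (K'.induce X).bicliqueGraph,
      ∀ F, (φ F).1 = Subtype.val ⁻¹' (f F.1.1) := by
  have him : ∀ F, K.IsBiclique F → p F →
      Subtype.val '' (Subtype.val ⁻¹' (f F) : Set X) = f F := fun F h1 h2 => by
    rw [Set.image_preimage_eq_iff, Subtype.range_val]
    exact (hf F h1 h2).subset
  have heq : ∀ F E, K.IsBiclique F → p F → K.IsBiclique E → p E →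
      (Subtype.val ⁻¹' (f F) : Set X) = Subtype.val ⁻¹' (f E) → F = E := by
    intro F E h1 h2 h3 h4 h5
    have h6 : f F = f E := by rw [← him F h1 h2, ← him E h3 h4, h5]
    exact (hinj F E h1 h2 h3 h4 h6).antisymm (hinj E F h3 h4 h1 h2 h6.symm)
  let g : {F : {B : Set U // K.IsBiclique B} // F ∈ {F | p F.1}} →
      {B : Set X // (K'.induce X).IsBiclique B} := fun F =>
    ⟨Subtype.val ⁻¹' (f F.1.1), isBiclique_induce_iff.2 (by
      rw [him F.1.1 F.1.2 F.2]
      exact hf F.1.1 F.1.2 F.2)⟩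
  have hg : Function.Bijective g := by
    constructor
    · rintro ⟨⟨F, hF⟩, hpF⟩ ⟨⟨E, hE⟩, hpE⟩ h
      have h' := congrArg Subtype.val h
      simp only [Subtype.mk.injEq]
      exact heq F E hF hpF hE hpE h'
    · rintro ⟨F', hF'⟩
      obtain ⟨F, hF, hp, hFF⟩ := hsurj _ (isBiclique_induce_iff.1 hF')
      refine ⟨⟨⟨F, hF⟩, hp⟩, Subtype.ext ?_⟩
      change Subtype.val ⁻¹' (f F) = F'
      rw [hFF, Set.preimage_image_eq _ Subtype.val_injective]
  refine ⟨⟨Equiv.ofBijective g hg, ?_⟩, fun F => rfl⟩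
  rintro ⟨⟨F, hF⟩, hpF⟩ ⟨⟨E, hE⟩, hpE⟩
  change (g _ ≠ g _ ∧ (Subtype.val ⁻¹' (f F) ∩ Subtype.val ⁻¹' (f E) : Set X).Nonempty) ↔
    ((⟨F, hF⟩ : {B : Set U // K.IsBiclique B}) ≠ ⟨E, hE⟩ ∧ (F ∩ E).Nonempty)
  rw [hg.1.ne_iff, ← hmeet F E hF hpF hE hpE]
  refine and_congr (by simp) ?_
  constructor
  · rintro ⟨u, h1, h2⟩
    exact ⟨u, h1, h2⟩
  · rintro ⟨u, h1, h2⟩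
    exact ⟨⟨u, (hf F hF hpF).subset h1⟩, h1, h2⟩

/-- A biclique is a union of classes of false twins. -/
theorem IsBiclique.mem_of_neighborSet_eq {F : Set U} (hF : K.IsBiclique F) {u t : U}
    (hu : u ∈ F) (h : K.neighborSet u = K.neighborSet t) : t ∈ F := by
  have hadj : ∀ a, K.Adj t a ↔ K.Adj u a := fun a => (Set.ext_iff.1 h a).symm
  have hadj' : ∀ a, K.Adj a t ↔ K.Adj a u := fun a => by
    rw [K.adj_comm, hadj, K.adj_comm]
  refine (isBiclique_iff.1 hF).2 t ?_
  obtain ⟨⟨a, ha, b, hb, hab⟩, hx⟩ := inducesCompleteBipartite_iff.1 hF.1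
  refine inducesCompleteBipartite_iff.2 ⟨⟨a, .inr ha, b, .inr hb, hab⟩, ?_⟩
  rintro a (rfl | ha) b (rfl | hb) c (rfl | hc) <;> (try simp only [hadj, hadj']) <;>
    apply hx <;> assumption

section FalseTwins

variable {R : Set U}

theorem IsFalseTwinTransversal.eq_of_neighborSet_eq (hR : K.IsFalseTwinTransversal R) (a b : R)
    (h : (K.induce R).neighborSet a = (K.induce R).neighborSet b) : a = b := by
  have key : ∀ a b : R, (K.induce R).neighborSet a = (K.induce R).neighborSet b →
      ∀ u, K.Adj a u → K.Adj b u := by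
    intro a b h u hau
    obtain ⟨r, ⟨hr, hru⟩, -⟩ := hR u
    have h1 : ∀ s, K.Adj s u ↔ K.Adj s r := fun s => by
      rw [K.adj_comm, K.adj_comm s]
      exact (Set.ext_iff.1 hru s).symm
    have h2 := Set.ext_iff.1 h ⟨r, hr⟩
    simp only [mem_neighborSet, induce_adj] at h2
    rw [h1, ← h2, ← h1]
    exact hau
  have hN : K.neighborSet a = K.neighborSet b := by
    ext u
    exact ⟨key a b h u, key b a h.symm u⟩
  exact Subtype.ext ((hR b).unique ⟨a.2, hN⟩ ⟨b.2, rfl⟩)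

theorem exists_isFalseTwinTransversal (K : SimpleGraph U) :
    ∃ R : Set U, K.IsFalseTwinTransversal R := by
  rcases isEmpty_or_nonempty U with hU | hU
  · exact ⟨∅, fun u => hU.elim u⟩
  let ρ : U → U := fun u =>
    Function.invFun K.neighborSet (K.neighborSet u)
  have hρ : ∀ u, K.neighborSet (ρ u) = K.neighborSet u := fun u =>
    Function.invFun_eq ⟨u, rfl⟩
  refine ⟨Set.range ρ, fun u => ⟨ρ u, ⟨⟨u, rfl⟩, hρ u⟩, ?_⟩⟩
  rintro _ ⟨⟨t, rfl⟩, h⟩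
  rw [hρ] at h
  simp only [ρ, h]

/-- The retraction onto a transversal of the classes of false twins. -/
theorem IsFalseTwinTransversal.exists_retraction (hR : K.IsFalseTwinTransversal R) :
    ∃ ρ : U → R, (∀ r : R, ρ r = r) ∧ (∀ u, K.neighborSet (ρ u) = K.neighborSet u) ∧
      ∀ a b, K.Adj (ρ a) (ρ b) ↔ K.Adj a b := by
  choose ρ hρ hu using hR
  have h1 : ∀ a b, K.Adj (ρ a) b ↔ K.Adj a b := fun a b => Set.ext_iff.1 (hρ a).2 b
  refine ⟨fun u => ⟨ρ u, (hρ u).1⟩, fun r => Subtype.ext (hu r r ⟨r.2, rfl⟩).symm,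
    fun u => (hρ u).2, fun a b => ?_⟩
  change K.Adj (ρ a) (ρ b) ↔ K.Adj a b
  rw [h1, K.adj_comm, h1, K.adj_comm]

theorem IsFalseTwinTransversal.connected_induce (hR : K.IsFalseTwinTransversal R)
    (hK : K.Connected) : (K.induce R).Connected := by
  obtain ⟨ρ, h1, -, h3⟩ := hR.exists_retraction
  exact hK.map (⟨ρ, fun {a b} h => (h3 a b).2 h⟩ : K →g K.induce R) fun r => ⟨r, h1 r⟩

/-- Identifying false twins does not change the biclique graph. -/
theorem IsFalseTwinTransversal.exists_iso (hR : K.IsFalseTwinTransversal R) :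
    ∃ φ : K.bicliqueGraph ≃g (K.induce R).bicliqueGraph,
      ∀ F, (φ F).1 = {r : R | (r : U) ∈ F.1} := by
  obtain ⟨ρ, h1, h2, h3⟩ := hR.exists_retraction
  have hmem : ∀ F, K.IsBiclique F → ∀ u, (ρ u : U) ∈ F ↔ u ∈ F := fun F hF u =>
    ⟨fun h => hF.mem_of_neighborSet_eq h (h2 u), fun h => hF.mem_of_neighborSet_eq h (h2 u).symm⟩
  have himg : ∀ F, K.InducesCompleteBipartite ((fun u => (ρ u : U)) '' F) ↔
      K.InducesCompleteBipartite F := fun F =>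
    inducesCompleteBipartite_image_iff fun a _ b _ => h3 a b
  refine (exists_bicliqueGraph_iso (K := K) (K' := K) (p := fun _ => True) (X := R)
    (fun F => F ∩ R) ?_ ?_ ?_ ?_).elim fun φ hφ => ?_
  · intro F hF _
    have hFR : (fun u => (ρ u : U)) '' F = F ∩ R := by
      ext r
      constructor
      · rintro ⟨u, hu, rfl⟩
        exact ⟨(hmem F hF u).2 hu, (ρ u).2⟩
      · rintro ⟨hr, hrR⟩
        exact ⟨r, hr, congrArg Subtype.val (h1 ⟨r, hrR⟩)⟩
    refine ⟨Set.inter_subset_right, ?_, fun u hu hins => ⟨?_, hu⟩⟩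
    · rw [← hFR, himg]
      exact hF.1
    · refine (isBiclique_iff.1 hF).2 u ((himg _).1 ?_)
      rw [Set.image_insert_eq, hFR]
      have : (ρ u : U) = u := congrArg Subtype.val (h1 ⟨u, hu⟩)
      rwa [this]
  · intro F' hF'
    have hρ : ∀ r ∈ R, (ρ r : U) = r := fun r hr => congrArg Subtype.val (h1 ⟨r, hr⟩)
    have himF : (fun u => (ρ u : U)) '' {u | (ρ u : U) ∈ F'} = F' := by
      ext r
      constructor
      · rintro ⟨u, hu, rfl⟩
        exact hu
      · intro hr
        have := hρ r (hF'.subset hr)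
        exact ⟨r, by simpa [this] using hr, this⟩
    refine ⟨{u | (ρ u : U) ∈ F'}, isBiclique_iff.2 ⟨?_, fun u hins => ?_⟩, trivial, ?_⟩
    · rw [← himg, himF]
      exact hF'.induces
    · refine hF'.mem _ (ρ u).2 ?_
      rw [← himg, Set.image_insert_eq, himF] at hins
      exact hins
    · ext r
      constructor
      · rintro ⟨hr, hrR⟩
        have := hρ r hrR
        simpa [this] using hr
      · intro hr
        have := hρ r (hF'.subset hr)
        exact ⟨by simpa [this] using hr, hF'.subset hr⟩
  · intro F E hF _ hE _ h u hu
    have : (ρ u : U) ∈ F ∩ R := ⟨(hmem F hF u).2 hu, (ρ u).2⟩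
    rw [h] at this
    exact (hmem E hE u).1 this.1
  · intro F E hF _ hE _
    constructor
    · rintro ⟨u, ⟨h1, -⟩, h2, -⟩
      exact ⟨u, h1, h2⟩
    · rintro ⟨u, h1, h2⟩
      exact ⟨ρ u, ⟨(hmem F hF u).2 h1, (ρ u).2⟩, (hmem E hE u).2 h2, (ρ u).2⟩
  · refine ⟨⟨⟨fun F => φ ⟨F, trivial⟩, fun E => (φ.symm E).1, fun F => ?_, fun E => ?_⟩, ?_⟩,
      fun F => ?_⟩
    · exact congrArg Subtype.val (φ.symm_apply_apply _)
    · exact φ.apply_symm_apply E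
    · intro F E
      exact φ.map_rel_iff (a := ⟨F, trivial⟩) (b := ⟨E, trivial⟩)
    · change (φ ⟨F, trivial⟩).1 = _
      rw [hφ]
      ext r
      simp

end FalseTwins

section PendantVertex

variable {a b c : U}

/-- A pendant vertex `a` at `b` may be removed if `b` has a second neighbour. -/
theorem connected_induce_of_pendant (hK : K.Connected) (hac : a ≠ c)
    (ha : K.neighborSet a = {b}) (hb : K.neighborSet b = {a, c}) :
    (K.induce {a}ᶜ).Connected := by
  classical
  have ha' : ∀ u, K.Adj a u ↔ u = b := fun u => by simpa using Set.ext_iff.1 ha u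
  have hb' : ∀ u, K.Adj b u ↔ u = a ∨ u = c := fun u => by simpa using Set.ext_iff.1 hb u
  have hcb : K.Adj c b := ((hb' c).2 (.inr rfl)).symm
  -- Send `a` to `c`: every neighbour of `a` is a neighbour of `c`.
  let ρ : U → ({a}ᶜ : Set U) := fun u =>
    if h : u = a then ⟨c, fun hh => hac hh.symm⟩ else ⟨u, h⟩
  have hρa : (ρ a : U) = c := by simp [ρ]
  have hρ : ∀ u, u ≠ a → (ρ u : U) = u := fun u hu => by simp [ρ, hu]
  refine hK.map (⟨ρ, fun {s t} h => ?_⟩ : K →g K.induce {a}ᶜ) fun r => ⟨r, Subtype.ext ?_⟩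
  · change K.Adj (ρ s) (ρ t)
    by_cases hs : s = a
    · subst hs
      have ht := (ha' t).1 h
      subst ht
      rw [hρa, hρ t h.ne']
      exact hcb
    · by_cases ht : t = a
      · subst ht
        have hs' := (ha' s).1 h.symm
        subst hs'
        rw [hρa, hρ s hs]
        exact hcb.symm
      · rw [hρ s hs, hρ t ht]
        exact h
  · exact hρ r r.2

/-- Removing the pendant vertex `a` removes from the biclique graph the vertex `{a, b, c}` and
nothing else. -/
theorem nonempty_iso_of_pendant (htw : ∀ a b, K.neighborSet a = K.neighborSet b → a = b)
    (hac : a ≠ c) (ha : K.neighborSet a = {b}) (hb : K.neighborSet b = {a, c}) :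
    Nonempty (K.bicliqueGraph.induce {F | F.1 ≠ {b} ∪ {a, c}} ≃g
      (K.induce {a}ᶜ).bicliqueGraph) := by
  have ha' : ∀ u, K.Adj a u ↔ u = b := fun u => by simpa using Set.ext_iff.1 ha u
  have hb' : ∀ u, K.Adj b u ↔ u = a ∨ u = c := fun u => by simpa using Set.ext_iff.1 hb u
  have hab : K.Adj a b := (ha' b).2 rfl
  have hbc : K.Adj b c := (hb' c).2 (.inr rfl)
  have hnac : ¬ K.Adj a c := fun h => hbc.ne ((ha' c).1 h).symm
  have hB : K.InducesCompleteBipartite ({b} ∪ {a, c}) := by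
    convert inducesCompleteBipartite_path hab hbc hnac using 1
    ext u
    simp only [Set.mem_union, Set.mem_insert_iff, Set.mem_singleton_iff]
    tauto
  have hsub : ∀ F, K.InducesCompleteBipartite F → a ∈ F → b ∈ F ∧ F ⊆ {b} ∪ {a, c} := by
    intro F hF haF
    obtain ⟨t, ht, hat⟩ := hF.exists_adj haF
    obtain rfl := (ha' t).1 hat
    refine ⟨ht, fun u hu => ?_⟩
    have h1 := hF.adj_iff haF ht hu hat
    rw [ha', hb'] at h1
    simp only [Set.mem_union, Set.mem_insert_iff, Set.mem_singleton_iff]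
    tauto
  have haF : ∀ F, K.IsBiclique F → F ≠ {b} ∪ {a, c} → a ∉ F := fun F hF hne h =>
    hne ((hsub F hF.1 h).2.antisymm (hF.2 hB (hsub F hF.1 h).2))
  refine (exists_bicliqueGraph_iso (K := K) (K' := K) (p := fun F => F ≠ {b} ∪ {a, c})
    (X := {a}ᶜ) id ?_ ?_ ?_ ?_).elim fun φ _ => ⟨φ⟩
  · intro F hF hne
    refine ⟨fun u hu hua => haF F hF hne ?_, hF.1, fun u _ => (isBiclique_iff.1 hF).2 u⟩
    obtain rfl : u = a := hua
    exact hu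
  · intro F hF
    have haF : a ∉ F := fun h => hF.subset h rfl
    refine ⟨F, isBiclique_iff.2 ⟨hF.induces, fun u hins => ?_⟩, ?_, rfl⟩
    · by_cases hua : u = a
      · subst hua
        exfalso
        obtain ⟨h1, h2⟩ := hsub _ hins (Set.mem_insert u F)
        have hbF : b ∈ F := h1.resolve_left hab.ne'
        have hFbc : ∀ t ∈ F, t = b ∨ t = c := by
          intro t ht
          have := h2 (.inr ht)
          simp only [Set.mem_union, Set.mem_insert_iff, Set.mem_singleton_iff] at this
          rcases this with h | rfl | h
          exacts [.inl h, absurd ht haF, .inr h]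
        obtain ⟨s, hsF, hbs⟩ := hF.induces.exists_adj hbF
        obtain rfl : s = c := (hFbc s hsF).resolve_left hbs.ne'
        -- As `u` and `s` are not false twins, `s` has a neighbour `z ≠ b`, which extends `F`.
        obtain ⟨z, hz, hzb⟩ : ∃ z, K.Adj s z ∧ z ≠ b := by
          by_contra! hcon
          refine hac (htw u s ?_)
          ext t
          simp only [mem_neighborSet, ha']
          exact ⟨fun h => h ▸ hbc.symm, hcon t⟩
        have hzu : z ≠ u := fun h => hnac (h ▸ hz.symm)
        have hbz : ¬ K.Adj b z := fun h => by
          rcases (hb' z).1 h with h | h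
          exacts [hzu h, hz.ne h.symm]
        have hzF : z ∈ F := hF.mem z hzu ((inducesCompleteBipartite_path hbc hz hbz).subset
          (a := b) (b := s) (by
            rintro t (rfl | ht)
            · simp
            · rcases hFbc t ht with h | h <;> simp [h]) (.inr hbF) (.inr hsF) hbc)
        rcases hFbc z hzF with h | h
        exacts [hzb h, hz.ne h.symm]
      · exact hF.mem u hua hins
    · rintro rfl
      exact haF (by simp)
  · intro F E _ _ _ _ h
    exact (show F = E from h).le
  · intros
    rfl

end PendantVertex

/-! ### The split graph and its bicliques -/

theorem inducesCompleteBipartite_of_star {c b : U} {F : Set U} (hc : c ∈ F) (hb : b ∈ F)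
    (hcb : c ≠ b) (hadj : ∀ u ∈ F, u ≠ c → K.Adj c u)
    (hind : ∀ u ∈ F, ∀ t ∈ F, u ≠ c → t ≠ c → ¬ K.Adj u t) : K.InducesCompleteBipartite F := by
  refine ⟨{c}, F \ {c}, ⟨c, rfl⟩, ⟨b, hb, hcb.symm⟩, ?_, ?_, ?_, ?_⟩
  · rw [Set.union_sdiff_self]
    exact Set.union_eq_right.2 (by simpa using hc)
  · rintro _ rfl _ rfl hne
    exact absurd rfl hne
  · rintro u ⟨hu, huc⟩ t ⟨ht, htc⟩ -
    exact hind u hu t ht huc htc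
  · rintro _ rfl u ⟨hu, huc⟩
    exact hadj u hu huc

/-- The vertices `v`, `w`, `x` form a triangle in which `v` and `w` have no further neighbours,
and the further neighbours of `x` form a non-empty independent set. -/
structure IsPendantTriangle (K : SimpleGraph U) (v w x : U) : Prop where
  ne_vw : v ≠ w
  ne_vx : v ≠ x
  ne_wx : w ≠ x
  adj_v : ∀ u, K.Adj v u ↔ u = w ∨ u = x
  adj_w : ∀ u, K.Adj w u ↔ u = v ∨ u = x
  indep : ∀ i j, K.Adj x i → i ≠ v → i ≠ w → K.Adj x j → j ≠ v → j ≠ w → ¬ K.Adj i j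
  nonempty : ∃ i, K.Adj x i ∧ i ≠ v ∧ i ≠ w

namespace IsPendantTriangle

variable {v w x : U}

theorem swap (h : K.IsPendantTriangle v w x) : K.IsPendantTriangle w v x where
  ne_vw := h.ne_vw.symm
  ne_vx := h.ne_wx
  ne_wx := h.ne_vx
  adj_v := h.adj_w
  adj_w := h.adj_v
  indep i j h1 h2 h3 h4 h5 h6 := h.indep i j h1 h3 h2 h4 h6 h5
  nonempty := let ⟨i, h1, h2, h3⟩ := h.nonempty; ⟨i, h1, h3, h2⟩

/-- The closed star at `x` without `v` and `w`, together with the vertex `p`. -/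
def starWith (K : SimpleGraph U) (v w x p : U) : Set U :=
  {u | u = x ∨ u = p ∨ (K.Adj x u ∧ u ≠ v ∧ u ≠ w)}

theorem starWith_swap (p : U) : starWith K w v x p = starWith K v w x p := by
  ext u
  simp only [starWith, Set.mem_ofPred_eq]
  tauto

theorem induces_starWith (h : K.IsPendantTriangle v w x) {p : U} (hp : p = v ∨ p = w ∨ p = x) :
    K.InducesCompleteBipartite (starWith K v w x p) := by
  obtain ⟨i, hi, hiv, hiw⟩ := h.nonempty
  have hv := h.adj_v
  have hw := h.adj_w
  have hs := K.adj_comm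
  refine inducesCompleteBipartite_of_star (c := x) (b := i) (.inl rfl) (.inr (.inr ⟨hi, hiv, hiw⟩))
    hi.ne ?_ ?_
  · rintro u (rfl | rfl | hu) hne
    · exact absurd rfl hne
    · have := hv x
      have := hw x
      grind
    · exact hu.1
  · have key : ∀ j, K.Adj x j → j ≠ v → j ≠ w → p ≠ x → ¬ K.Adj p j := by
      intro j h1 h2 h3 h4
      have := hv j
      have := hw j
      have := h1.ne
      grind
    rintro u (rfl | rfl | hu) t (rfl | rfl | ht) hne hne'
    · exact absurd rfl hne
    · exact absurd rfl hne
    · exact absurd rfl hne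
    · exact absurd rfl hne'
    · exact K.loopless.irrefl _
    · exact key t ht.1 ht.2.1 ht.2.2 hne
    · exact absurd rfl hne'
    · exact fun hh => key u hu.1 hu.2.1 hu.2.2 hne' hh.symm
    · exact h.indep u t hu.1 hu.2.1 hu.2.2 ht.1 ht.2.1 ht.2.2

theorem subset_starWith (h : K.IsPendantTriangle v w x) {F : Set U}
    (hF : K.InducesCompleteBipartite F) (hv : v ∈ F) : F ⊆ {v, w} ∨ F ⊆ starWith K v w x v := by
  have h0 := h.ne_vw
  have h1 := h.ne_vx
  have h2 := h.ne_wx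
  have hs := K.adj_comm
  obtain ⟨t, ht, hvt⟩ := hF.exists_adj hv
  rcases (h.adj_v t).1 hvt with rfl | rfl
  · left
    intro u hu
    have := hF.adj_iff hv ht hu hvt
    rw [h.adj_v, h.adj_w] at this
    simp only [Set.mem_insert_iff, Set.mem_singleton_iff]
    tauto
  · right
    intro u hu
    have := hF.adj_iff hv ht hu hvt
    rw [h.adj_v] at this
    simp only [starWith, Set.mem_ofPred_eq]
    have : ¬ K.Adj t t := K.loopless.irrefl t
    by_cases huw : u = w
    · subst huw
      have := (h.adj_w t).2 (.inr rfl)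
      have := this.symm
      tauto
    · tauto

theorem not_mem_w_starWith (h : K.IsPendantTriangle v w x) : w ∉ starWith K v w x v := by
  have := h.ne_vw
  have := h.ne_wx
  simp only [starWith, Set.mem_ofPred_eq]
  tauto

theorem isBiclique_starWith (h : K.IsPendantTriangle v w x) :
    K.IsBiclique (starWith K v w x v) := by
  refine ⟨h.induces_starWith (.inl rfl), fun F hF hsub => ?_⟩
  rcases h.subset_starWith hF (hsub (.inr (.inl rfl))) with h1 | h1
  · have h2 := h1 (hsub (.inl rfl))
    have := h.ne_vx.symm
    have := h.ne_wx.symm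
    simp only [Set.mem_insert_iff, Set.mem_singleton_iff] at h2
    tauto
  · exact h1

theorem isBiclique_starWith' (h : K.IsPendantTriangle v w x) :
    K.IsBiclique (starWith K v w x w) :=
  starWith_swap (K := K) (v := v) (w := w) w ▸ h.swap.isBiclique_starWith

theorem eq_starWith (h : K.IsPendantTriangle v w x) {F : Set U} (hF : K.IsBiclique F)
    (hne : F ≠ {v, w}) (hv : v ∈ F) : F = starWith K v w x v := by
  rcases h.subset_starWith hF.1 hv with h1 | h1
  · exact absurd (h1.antisymm (hF.2 (inducesCompleteBipartite_pair ((h.adj_v w).2 (.inl rfl))) h1))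
      hne
  · exact hF.eq_of_subset h.isBiclique_starWith h1

theorem eq_starWith' (h : K.IsPendantTriangle v w x) {F : Set U} (hF : K.IsBiclique F)
    (hne : F ≠ {v, w}) (hw : w ∈ F) : F = starWith K v w x w := by
  rw [← starWith_swap]
  exact h.swap.eq_starWith hF (by rwa [Set.pair_comm]) hw

/-- The vertex of the original graph that a vertex of the split graph comes from; the pendant
vertices come from `v` and `w`. -/
def proj (x : U) : SplitVertex v w → U
  | .old u _ _ => u
  | .copy => x
  | .pendant => v
  | .copyPendant => w

/-- The vertices of the split graph other than the two pendant vertices. -/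
def core (v w : U) : Set (SplitVertex v w) := {s | s ≠ .pendant ∧ s ≠ .copyPendant}

theorem splitGraph_adj_pendant (s : SplitVertex v w) :
    (K.splitGraph v w x).Adj .pendant s ↔ ∃ h1 h2, s = .old x h1 h2 := by
  cases s with
  | old u h1 h2 =>
    change u = x ↔ _
    constructor
    · rintro rfl
      exact ⟨h1, h2, rfl⟩
    · rintro ⟨_, _, h⟩
      exact (SplitVertex.old.inj h)
  | _ => exact ⟨fun h => h.elim, fun ⟨_, _, h⟩ => by cases h⟩

theorem splitGraph_adj_copyPendant (s : SplitVertex v w) :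
    (K.splitGraph v w x).Adj .copyPendant s ↔ s = .copy := by
  cases s with
  | copy => exact ⟨fun _ => rfl, fun _ => trivial⟩
  | _ => exact ⟨fun h => h.elim, fun h => by cases h⟩

theorem splitGraph_adj_core {s t : SplitVertex v w} (hs : s ∈ core v w) (ht : t ∈ core v w) :
    K.Adj (proj x s) (proj x t) ↔ (K.splitGraph v w x).Adj s t := by
  obtain ⟨hs1, hs2⟩ := hs
  obtain ⟨ht1, ht2⟩ := ht
  cases s <;> cases t <;> first
    | exact absurd rfl hs1
    | exact absurd rfl hs2
    | exact absurd rfl ht1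
    | exact absurd rfl ht2
    | exact Iff.rfl
    | exact K.adj_comm _ _
    | exact ⟨fun h => (K.loopless.irrefl _ h).elim, fun h => h.elim⟩

theorem induces_image_iff {F : Set (SplitVertex v w)} (hF : F ⊆ core v w) :
    K.InducesCompleteBipartite (proj x '' F) ↔ (K.splitGraph v w x).InducesCompleteBipartite F :=
  inducesCompleteBipartite_image_iff fun _ ha _ hb => splitGraph_adj_core (hF ha) (hF hb)

/-- The set of vertices of the split graph, other than the pendant vertices, that come from
`F`. -/
def lift (v w x : U) (F : Set U) : Set (SplitVertex v w) := {s | s ∈ core v w ∧ proj x s ∈ F}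

theorem lift_subset {F : Set U} : lift v w x F ⊆ core v w := fun _ h => h.1

theorem proj_ne {s : SplitVertex v w} (h : K.IsPendantTriangle v w x) (hs : s ∈ core v w) :
    proj x s ≠ v ∧ proj x s ≠ w := by
  obtain ⟨h1, h2⟩ := hs
  cases s with
  | old u hv hw => exact ⟨hv, hw⟩
  | copy => exact ⟨h.ne_vx.symm, h.ne_wx.symm⟩
  | pendant => exact absurd rfl h1
  | copyPendant => exact absurd rfl h2

theorem old_mem_core {u : U} (hv : u ≠ v) (hw : u ≠ w) : SplitVertex.old u hv hw ∈ core v w :=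
  ⟨by simp, by simp⟩

theorem copy_mem_core : SplitVertex.copy ∈ core v w := ⟨by simp, by simp⟩

theorem image_lift {F : Set U} (hv : v ∉ F) (hw : w ∉ F) : proj x '' lift v w x F = F := by
  ext u
  constructor
  · rintro ⟨s, hs, rfl⟩
    exact hs.2
  · intro hu
    have h1 : u ≠ v := fun h => hv (h ▸ hu)
    have h2 : u ≠ w := fun h => hw (h ▸ hu)
    exact ⟨.old u h1 h2, ⟨old_mem_core h1 h2, hu⟩, rfl⟩

theorem induces_lift_iff {F : Set U} (hv : v ∉ F) (hw : w ∉ F) :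
    (K.splitGraph v w x).InducesCompleteBipartite (lift v w x F) ↔
      K.InducesCompleteBipartite F := by
  rw [← induces_image_iff lift_subset, image_lift hv hw]

/-- A pendant vertex does not extend a complete bipartite set `lift v w x F`: such a set contains
the neighbour of the pendant vertex only together with a false twin of that neighbour. -/
theorem not_induces_insert_pendant (h : K.IsPendantTriangle v w x) (F : Set U) :
    ¬ (K.splitGraph v w x).InducesCompleteBipartite (insert .pendant (lift v w x F)) ∧
    ¬ (K.splitGraph v w x).InducesCompleteBipartite (insert .copyPendant (lift v w x F)) := by
  have hold : ∀ s, s = .pendant ∨ s = .copyPendant →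
      ¬ (K.splitGraph v w x).InducesCompleteBipartite (insert s (lift v w x F)) := by
    intro s hs hcb
    obtain ⟨t, ht, hst⟩ := hcb.exists_adj (Set.mem_insert s _)
    have hx : x ∈ F := by
      have hts := ht.resolve_left hst.ne'
      rcases hs with rfl | rfl
      · obtain ⟨h1, h2, rfl⟩ := (splitGraph_adj_pendant t).1 hst
        exact hts.2
      · obtain rfl := (splitGraph_adj_copyPendant t).1 hst
        exact hts.2
    have m1 : SplitVertex.old x h.ne_vx.symm h.ne_wx.symm ∈ insert s (lift v w x F) :=
      .inr ⟨old_mem_core _ _, hx⟩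
    have m2 : SplitVertex.copy ∈ insert s (lift v w x F) := .inr ⟨copy_mem_core, hx⟩
    have nadj : ¬ (K.splitGraph v w x).Adj (.old x h.ne_vx.symm h.ne_wx.symm) .copy :=
      K.loopless.irrefl x
    rcases hs with rfl | rfl
    · have := hcb.adj_iff (Set.mem_insert _ _) m1 m2 ((splitGraph_adj_pendant _).2 ⟨_, _, rfl⟩)
      exact this.2 nadj
    · have := hcb.adj_iff (Set.mem_insert _ _) m2 m1 ((splitGraph_adj_copyPendant _).2 rfl)
      exact this.2 fun hh => nadj hh.symm
  exact ⟨hold _ (.inl rfl), hold _ (.inr rfl)⟩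

theorem isBicliqueOn_lift (h : K.IsPendantTriangle v w x) {X : Set (SplitVertex v w)}
    (hX : core v w ⊆ X) {F : Set U} (hF : K.InducesCompleteBipartite F) (hv : v ∉ F) (hw : w ∉ F)
    (hext : ∀ u, u ≠ v → u ≠ w → K.InducesCompleteBipartite (insert u F) → u ∈ F) :
    (K.splitGraph v w x).IsBicliqueOn X (lift v w x F) := by
  refine ⟨lift_subset.trans hX, (induces_lift_iff hv hw).2 hF, fun s _ hins => ?_⟩
  by_cases hs : s ∈ core v w
  · refine ⟨hs, hext _ (h.proj_ne hs).1 (h.proj_ne hs).2 ?_⟩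
    rw [← induces_image_iff (Set.insert_subset hs lift_subset), Set.image_insert_eq,
      image_lift hv hw] at hins
    exact hins
  · exfalso
    have := h.not_induces_insert_pendant F
    cases s with
    | old u h1 h2 => exact hs (old_mem_core h1 h2)
    | copy => exact hs copy_mem_core
    | pendant => exact this.1 hins
    | copyPendant => exact this.2 hins

theorem not_mem_starWith_x (h : K.IsPendantTriangle v w x) :
    v ∉ starWith K v w x x ∧ w ∉ starWith K v w x x := by
  have := h.ne_vx
  have := h.ne_wx
  simp only [starWith, Set.mem_ofPred_eq]
  tauto

/-- A biclique of the split graph without pendant vertices comes from a biclique of the original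
graph, or is the closed star at `x` and its copy. -/
theorem exists_eq_lift (h : K.IsPendantTriangle v w x) {X F' : Set (SplitVertex v w)}
    (hX : core v w ⊆ X) (hF' : (K.splitGraph v w x).IsBicliqueOn X F') (hcore : F' ⊆ core v w) :
    ∃ F : Set U, v ∉ F ∧ w ∉ F ∧ F' = lift v w x F ∧
      (K.IsBiclique F ∨ F = starWith K v w x x) := by
  have hv : v ∉ proj x '' F' := by
    rintro ⟨s, hs, hsv⟩
    exact (h.proj_ne (hcore hs)).1 hsv
  have hw : w ∉ proj x '' F' := by
    rintro ⟨s, hs, hsv⟩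
    exact (h.proj_ne (hcore hs)).2 hsv
  have hmem : ∀ s ∈ core v w, K.InducesCompleteBipartite (insert (proj x s) (proj x '' F')) →
      s ∈ F' := by
    intro s hs hins
    refine hF'.mem s (hX hs) ?_
    rwa [← induces_image_iff (Set.insert_subset hs hcore), Set.image_insert_eq]
  have hcb : K.InducesCompleteBipartite (proj x '' F') := (induces_image_iff hcore).2 hF'.induces
  have hlift : F' = lift v w x (proj x '' F') := by
    ext s
    refine ⟨fun hs => ⟨hcore hs, s, hs, rfl⟩, fun hs => hmem s hs.1 ?_⟩
    rwa [Set.insert_eq_of_mem hs.2]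
  refine ⟨proj x '' F', hv, hw, hlift, ?_⟩
  by_cases hb : ∀ u, K.InducesCompleteBipartite (insert u (proj x '' F')) → u ∈ proj x '' F'
  · exact .inl (isBiclique_iff.2 ⟨hcb, hb⟩)
  · right
    push Not at hb
    obtain ⟨u, hins, hu⟩ := hb
    have huvw : u = v ∨ u = w := by
      by_contra! hcon
      exact hu ⟨.old u hcon.1 hcon.2, hmem _ (old_mem_core _ _) hins, rfl⟩
    have hsub : proj x '' F' ⊆ starWith K v w x x := by
      intro t ht
      have htv : t ≠ v := fun hh => hv (hh ▸ ht)
      have htw : t ≠ w := fun hh => hw (hh ▸ ht)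
      have htF : t ∈ insert u (proj x '' F') := .inr ht
      rcases huvw with rfl | rfl
      · have h1 := h.subset_starWith hins (Set.mem_insert u _)
        rcases h1 with h1 | h1
        · rcases h1 htF with h2 | h2
          exacts [absurd h2 htv, absurd h2 htw]
        · rcases h1 htF with h2 | h2 | h2
          exacts [.inl h2, absurd h2 htv, .inr (.inr h2)]
      · have h1 := h.swap.subset_starWith hins (Set.mem_insert u _)
        rcases h1 with h1 | h1
        · rcases h1 htF with h2 | h2
          exacts [absurd h2 htw, absurd h2 htv]
        · rcases h1 htF with h2 | h2 | h2
          exacts [.inl h2, absurd h2 htw, .inr (.inr ⟨h2.1, h2.2.2, h2.2.1⟩)]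
    have hcbx : (K.splitGraph v w x).InducesCompleteBipartite (lift v w x (starWith K v w x x)) :=
      (induces_lift_iff h.not_mem_starWith_x.1 h.not_mem_starWith_x.2).2
        (h.induces_starWith (.inr (.inr rfl)))
    have heq : F' = lift v w x (starWith K v w x x) :=
      hF'.eq_of_subset hcbx (lift_subset.trans hX) fun s hs => ⟨hcore hs, hsub ⟨s, hs, rfl⟩⟩
    rw [heq, image_lift h.not_mem_starWith_x.1 h.not_mem_starWith_x.2]

/-- The closed star at `x` in the split graph. -/
def pendantStar (K : SimpleGraph U) (v w x : U) : Set (SplitVertex v w) :=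
  {s | match s with
    | .old u _ _ => u = x ∨ K.Adj x u
    | .copy => False
    | .pendant => True
    | .copyPendant => False}

/-- The closed star at the copy of `x` in the split graph. -/
def copyStar (K : SimpleGraph U) (v w x : U) : Set (SplitVertex v w) :=
  {s | match s with
    | .old u _ _ => K.Adj x u
    | .copy => True
    | .pendant => False
    | .copyPendant => True}

theorem isBicliqueOn_pendantStar (h : K.IsPendantTriangle v w x) {X : Set (SplitVertex v w)}
    (hX : pendantStar K v w x ⊆ X) :
    (K.splitGraph v w x).IsBicliqueOn X (pendantStar K v w x) ∧
    ∀ F', (K.splitGraph v w x).IsBicliqueOn X F' → .pendant ∈ F' → F' = pendantStar K v w x := by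
  have hsub : ∀ F', (K.splitGraph v w x).InducesCompleteBipartite F' → .pendant ∈ F' →
      F' ⊆ pendantStar K v w x := by
    intro F' hF' hp s hs
    obtain ⟨t, ht, hpt⟩ := hF'.exists_adj hp
    have h1 := hF'.adj_iff hp ht hs hpt
    obtain ⟨e1, e2, rfl⟩ := (splitGraph_adj_pendant t).1 hpt
    cases s with
    | old u h3 h4 =>
      change u = x ∨ K.Adj x u
      by_contra! hcon
      obtain ⟨_, _, h5⟩ := (splitGraph_adj_pendant _).1 (h1.2 hcon.2)
      exact hcon.1 (SplitVertex.old.inj h5)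
    | copy =>
      have h2 : ¬ (K.splitGraph v w x).Adj (.old x e1 e2) .copy := K.loopless.irrefl x
      exact h1.2 h2
    | pendant => trivial
    | copyPendant =>
      have h2 : ¬ (K.splitGraph v w x).Adj (.old x e1 e2) .copyPendant := fun hh => hh
      exact h1.2 h2
  have hcb : (K.splitGraph v w x).InducesCompleteBipartite (pendantStar K v w x) := by
    refine inducesCompleteBipartite_of_star (c := .old x h.ne_vx.symm h.ne_wx.symm)
      (b := .pendant) (by exact Or.inl rfl) (by exact trivial) (by simp) ?_ ?_
    · intro s hs hne
      cases s with
      | old u h3 h4 => exact Or.resolve_left hs (fun hh => hne (by subst hh; rfl))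
      | copy => exact hs.elim
      | pendant => exact rfl
      | copyPendant => exact hs.elim
    · intro s hs t ht hne hne'
      cases s with
      | old u h3 h4 =>
        have hu : K.Adj x u := Or.resolve_left hs (fun hh => hne (by subst hh; rfl))
        cases t with
        | old u' h3' h4' =>
          have hu' : K.Adj x u' := Or.resolve_left ht (fun hh => hne' (by subst hh; rfl))
          exact h.indep u u' hu h3 h4 hu' h3' h4'
        | copy => exact ht.elim
        | pendant => exact fun hh => hu.ne' hh
        | copyPendant => exact ht.elim
      | copy => exact hs.elim
      | pendant =>
        rw [splitGraph_adj_pendant]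
        rintro ⟨_, _, rfl⟩
        exact hne' rfl
      | copyPendant => exact hs.elim
  refine ⟨⟨hX, hcb, fun s _ hins => ?_⟩, fun F' hF' hp => ?_⟩
  · exact hsub _ hins (.inr trivial) (Set.mem_insert s _)
  · exact hF'.eq_of_subset hcb hX (hsub F' hF'.induces hp)

theorem isBicliqueOn_copyStar (h : K.IsPendantTriangle v w x) :
    (K.splitGraph v w x).IsBicliqueOn Set.univ (copyStar K v w x) ∧
    ∀ F', (K.splitGraph v w x).IsBicliqueOn Set.univ F' → .copyPendant ∈ F' →
      F' = copyStar K v w x := by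
  have hsub : ∀ F', (K.splitGraph v w x).InducesCompleteBipartite F' → .copyPendant ∈ F' →
      F' ⊆ copyStar K v w x := by
    intro F' hF' hp s hs
    obtain ⟨t, ht, hpt⟩ := hF'.exists_adj hp
    have h1 := hF'.adj_iff hp ht hs hpt
    obtain rfl := (splitGraph_adj_copyPendant t).1 hpt
    cases s with
    | old u h3 h4 =>
      by_contra hcon
      have h2 : ¬ (K.splitGraph v w x).Adj .copy (.old u h3 h4) := fun hh => hcon (K.adj_symm hh)
      exact h1.2 h2
    | copy => trivial
    | pendant =>
      have h2 : ¬ (K.splitGraph v w x).Adj .copy .pendant := fun hh => hh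
      exact h1.2 h2
    | copyPendant => trivial
  have hcb : (K.splitGraph v w x).InducesCompleteBipartite (copyStar K v w x) := by
    refine inducesCompleteBipartite_of_star (c := .copy) (b := .copyPendant)
      (by exact trivial) (by exact trivial) (by simp) ?_ ?_
    · intro s hs hne
      cases s with
      | old u h3 h4 => exact K.adj_symm hs
      | copy => exact absurd rfl hne
      | pendant => exact hs.elim
      | copyPendant => trivial
    · intro s hs t ht hne hne'
      cases s with
      | old u h3 h4 =>
        cases t with
        | old u' h3' h4' => exact h.indep u u' hs h3 h4 ht h3' h4'
        | copy => exact absurd rfl hne'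
        | pendant => exact ht.elim
        | copyPendant => exact fun hh => hh
      | copy => exact absurd rfl hne
      | pendant => exact hs.elim
      | copyPendant =>
        rw [splitGraph_adj_copyPendant]
        exact hne'
  refine ⟨⟨Set.subset_univ _, hcb, fun s _ hins => ?_⟩, fun F' hF' hp => ?_⟩
  · exact hsub _ hins (.inr trivial) (Set.mem_insert s _)
  · exact hF'.eq_of_subset hcb (Set.subset_univ _) (hsub F' hF'.induces hp)

end IsPendantTriangle

/-! ### The biclique graph of the split graph -/

namespace IsPendantTriangle

variable {v w x : U}

/-- The correspondence of bicliques in the presence of both pendant vertices: the vertices `v` and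
`w` are replaced by the pendant vertices, and `x` by its copy where `w` is present, and by both
`x` and its copy where `v` and `w` are absent. -/
def splitMap (v w x : U) (F : Set U) : Set (SplitVertex v w) :=
  {s | match s with
    | .old u _ _ => u ∈ F ∧ (u = x → w ∉ F)
    | .copy => x ∈ F ∧ v ∉ F
    | .pendant => v ∈ F
    | .copyPendant => w ∈ F}

/-- The correspondence of bicliques when the copy of `x` has no pendant vertex. -/
def splitMap' (v w x : U) (F : Set U) : Set (SplitVertex v w) :=
  {s | match s with
    | .old u _ _ => u ∈ F
    | .copy => x ∈ F ∧ v ∉ F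
    | .pendant => v ∈ F
    | .copyPendant => False}

theorem splitMap_eq_lift {F : Set U} (hv : v ∉ F) (hw : w ∉ F) :
    splitMap v w x F = lift v w x F := by
  ext s
  cases s with
  | old u h1 h2 => exact ⟨fun h => ⟨old_mem_core h1 h2, h.1⟩, fun h => ⟨h.2, fun _ => hw⟩⟩
  | copy => exact ⟨fun h => ⟨copy_mem_core, h.1⟩, fun h => ⟨h.2, hv⟩⟩
  | pendant => exact ⟨fun h => (hv h).elim, fun h => (h.1.1 rfl).elim⟩
  | copyPendant => exact ⟨fun h => (hw h).elim, fun h => (h.1.2 rfl).elim⟩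

theorem splitMap'_eq_lift {F E : Set U} (hv : v ∉ F)
    (hE : ∀ u, u ≠ v → u ≠ w → (u ∈ E ↔ u ∈ F)) (hx : x ∈ E ↔ x ∈ F) :
    splitMap' v w x F = lift v w x E := by
  ext s
  cases s with
  | old u h1 h2 =>
    exact ⟨fun h => ⟨old_mem_core h1 h2, (hE u h1 h2).2 h⟩, fun h => (hE u h1 h2).1 h.2⟩
  | copy => exact ⟨fun h => ⟨copy_mem_core, hx.2 h.1⟩, fun h => ⟨hx.1 h.2, hv⟩⟩
  | pendant => exact ⟨fun h => (hv h).elim, fun h => (h.1.1 rfl).elim⟩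
  | copyPendant => exact ⟨fun h => h.elim, fun h => (h.1.2 rfl).elim⟩

theorem splitMap_starWith (h : K.IsPendantTriangle v w x) :
    splitMap v w x (starWith K v w x v) = pendantStar K v w x := by
  have hw := h.not_mem_w_starWith
  ext s
  cases s with
  | old u h1 h2 =>
    change (u = x ∨ u = v ∨ (K.Adj x u ∧ u ≠ v ∧ u ≠ w)) ∧ (u = x → w ∉ starWith K v w x v) ↔
      u = x ∨ K.Adj x u
    tauto
  | copy => exact ⟨fun hh => hh.2 (.inr (.inl rfl)), fun hh => hh.elim⟩
  | pendant => exact ⟨fun _ => trivial, fun _ => .inr (.inl rfl)⟩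
  | copyPendant => exact ⟨fun hh => hw hh, fun hh => hh.elim⟩

theorem splitMap'_starWith :
    splitMap' v w x (starWith K v w x v) = pendantStar K v w x := by
  ext s
  cases s with
  | old u h1 h2 =>
    change (u = x ∨ u = v ∨ (K.Adj x u ∧ u ≠ v ∧ u ≠ w)) ↔ u = x ∨ K.Adj x u
    tauto
  | copy => exact ⟨fun hh => hh.2 (.inr (.inl rfl)), fun hh => hh.elim⟩
  | pendant => exact ⟨fun _ => trivial, fun _ => .inr (.inl rfl)⟩
  | copyPendant => exact Iff.rfl

theorem splitMap_starWith' (h : K.IsPendantTriangle v w x) :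
    splitMap v w x (starWith K v w x w) = copyStar K v w x := by
  have hv : v ∉ starWith K v w x w := by
    rw [← starWith_swap]
    exact h.swap.not_mem_w_starWith
  have hw : w ∈ starWith K v w x w := .inr (.inl rfl)
  ext s
  cases s with
  | old u h1 h2 =>
    change (u = x ∨ u = w ∨ (K.Adj x u ∧ u ≠ v ∧ u ≠ w)) ∧ (u = x → w ∉ starWith K v w x w) ↔
      K.Adj x u
    have : ¬ K.Adj x x := K.loopless.irrefl x
    by_cases hux : u = x
    · subst hux
      tauto
    · tauto
  | copy => exact ⟨fun _ => trivial, fun _ => ⟨.inl rfl, hv⟩⟩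
  | pendant => exact ⟨fun hh => hv hh, fun hh => hh.elim⟩
  | copyPendant => exact ⟨fun _ => trivial, fun _ => hw⟩

theorem splitMap'_starWith' (h : K.IsPendantTriangle v w x) :
    splitMap' v w x (starWith K v w x w) = lift v w x (starWith K v w x x) := by
  refine splitMap'_eq_lift ?_ ?_ ?_
  · rw [← starWith_swap]
    exact h.swap.not_mem_w_starWith
  · intro u h1 h2
    simp only [starWith, Set.mem_ofPred_eq]
    tauto
  · exact ⟨fun _ => .inl rfl, fun _ => .inl rfl⟩

theorem connected_splitGraph (h : K.IsPendantTriangle v w x) (hK : K.Connected) :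
    (K.splitGraph v w x).Connected := by
  obtain ⟨i, hi, hiv, hiw⟩ := h.nonempty
  let o : SplitVertex v w := .old x h.ne_vx.symm h.ne_wx.symm
  have hold : ∀ u, u ∈ {u | ∀ h1 h2, (K.splitGraph v w x).Reachable o (.old u h1 h2)} := by
    refine hK.mem_of_closed (s := x) (fun h1 h2 => Reachable.refl _) ?_
    intro a ha b hab hbv hbw
    by_cases hav : a = v
    · obtain rfl := ((h.adj_v b).1 (hav ▸ hab)).resolve_left hbw
      exact Reachable.refl _
    · by_cases haw : a = w
      · obtain rfl := ((h.adj_w b).1 (haw ▸ hab)).resolve_left hbv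
        exact Reachable.refl _
      · exact (ha hav haw).trans (Adj.reachable (G := K.splitGraph v w x) hab)
  have hcopy : (K.splitGraph v w x).Reachable o .copy :=
    (hold i hiv hiw).trans (Adj.reachable (G := K.splitGraph v w x) (v := .copy) hi.symm)
  refine (connected_iff_exists_forall_reachable _).2 ⟨o, fun s => ?_⟩
  cases s with
  | old u h1 h2 => exact hold u h1 h2
  | copy => exact hcopy
  | pendant => exact Adj.reachable (G := K.splitGraph v w x) (v := .pendant) rfl
  | copyPendant =>
    exact hcopy.trans (Adj.reachable (G := K.splitGraph v w x) (v := .copyPendant) trivial)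

theorem connected_splitGraph_induce (h : K.IsPendantTriangle v w x) (hK : K.Connected) :
    ((K.splitGraph v w x).induce {SplitVertex.copyPendant}ᶜ).Connected := by
  obtain ⟨i, hi, hiv, hiw⟩ := h.nonempty
  -- Send the pendant vertex to a neighbour of its neighbour.
  let ρ : SplitVertex v w → ({SplitVertex.copyPendant}ᶜ : Set (SplitVertex v w)) := fun s =>
    match s with
    | .old u h1 h2 => ⟨.old u h1 h2, by simp⟩
    | .copy => ⟨.copy, by simp⟩
    | .pendant => ⟨.pendant, by simp⟩
    | .copyPendant => ⟨.old i hiv hiw, by simp⟩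
  refine (h.connected_splitGraph hK).map
    (⟨ρ, fun {s t} hst => ?_⟩ : K.splitGraph v w x →g _) fun ⟨s, hs⟩ => ⟨s, ?_⟩
  · change (K.splitGraph v w x).Adj (ρ s) (ρ t)
    cases s with
    | copyPendant =>
      obtain rfl := (splitGraph_adj_copyPendant t).1 hst
      exact K.adj_symm hi
    | _ =>
      cases t with
      | copyPendant =>
        first
          | exact hi.symm
          | exact hst.elim
      | _ => exact hst
  · cases s with
    | copyPendant => exact absurd rfl hs
    | _ => rfl

theorem nonempty_iso_splitGraph (h : K.IsPendantTriangle v w x)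
    (hz : ∃ z, z ≠ x ∧ ∀ i, K.Adj x i → i ≠ v → i ≠ w → K.Adj z i) :
    Nonempty (K.bicliqueGraph.induce {F | F.1 ≠ {v, w}} ≃g
      ((K.splitGraph v w x).induce Set.univ).bicliqueGraph) := by
  obtain ⟨z, hzx, hz⟩ := hz
  obtain ⟨i, hi, hiv, hiw⟩ := h.nonempty
  have hzv : z ≠ v := by
    rintro rfl
    have h1 := (h.adj_v i).1 (hz i hi hiv hiw)
    have := hi.ne'
    tauto
  have hzw : z ≠ w := by
    rintro rfl
    have h1 := (h.adj_w i).1 (hz i hi hiv hiw)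
    have := hi.ne'
    tauto
  have hvw : ∀ F : Set U, K.IsBiclique F → F ≠ {v, w} → v ∈ F → w ∉ F := fun F hF hne hv hw =>
    h.not_mem_w_starWith (h.eq_starWith hF hne hv ▸ hw)
  have hproj : ∀ F s, s ∈ splitMap v w x F → proj x s ∈ F := by
    intro F s hs
    cases s with
    | old u h1 h2 => exact hs.1
    | copy => exact hs.1
    | pendant => exact hs
    | copyPendant => exact hs
  refine (exists_bicliqueGraph_iso (K := K) (K' := K.splitGraph v w x) (p := fun F => F ≠ {v, w})
    (X := Set.univ) (splitMap v w x) ?_ ?_ ?_ ?_).elim fun φ _ => ⟨φ⟩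
  · intro F hF hne
    by_cases hv : v ∈ F
    · rw [h.eq_starWith hF hne hv, h.splitMap_starWith]
      exact (h.isBicliqueOn_pendantStar (Set.subset_univ _)).1
    · by_cases hw : w ∈ F
      · rw [h.eq_starWith' hF hne hw, h.splitMap_starWith']
        exact h.isBicliqueOn_copyStar.1
      · rw [splitMap_eq_lift hv hw]
        exact h.isBicliqueOn_lift (Set.subset_univ _) hF.1 hv hw
          fun u _ _ => (isBiclique_iff.1 hF).2 u
  · intro F' hF'
    by_cases hp : SplitVertex.pendant ∈ F'
    · refine ⟨_, h.isBiclique_starWith, ?_, ?_⟩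
      · intro heq
        have : x ∈ ({v, w} : Set U) := heq ▸ Or.inl rfl
        rcases this with h1 | h1
        exacts [h.ne_vx h1.symm, h.ne_wx h1.symm]
      · rw [h.splitMap_starWith]
        exact ((h.isBicliqueOn_pendantStar (Set.subset_univ _)).2 F' hF' hp).symm
    · by_cases hp' : SplitVertex.copyPendant ∈ F'
      · refine ⟨_, h.isBiclique_starWith', ?_, ?_⟩
        · intro heq
          have : x ∈ ({v, w} : Set U) := heq ▸ Or.inl rfl
          rcases this with h1 | h1
          exacts [h.ne_vx h1.symm, h.ne_wx h1.symm]
        · rw [h.splitMap_starWith']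
          exact (h.isBicliqueOn_copyStar.2 F' hF' hp').symm
      · have hcore : F' ⊆ core v w := fun s hs =>
          ⟨fun e => hp (e ▸ hs), fun e => hp' (e ▸ hs)⟩
        obtain ⟨F, hv, hw, rfl, hF | rfl⟩ := h.exists_eq_lift (Set.subset_univ _) hF' hcore
        · exact ⟨F, hF, fun heq => hv (heq ▸ Or.inl rfl), splitMap_eq_lift hv hw⟩
        · -- The vertex `z` extends the closed star at `x` and its copy.
          exfalso
          have hcb : K.InducesCompleteBipartite (insert z (starWith K v w x x)) := by
            have hnx : ¬ K.Adj x z := fun hh =>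
              K.loopless.irrefl z (hz z hh hzv hzw)
            refine ⟨{x, z}, {u | K.Adj x u ∧ u ≠ v ∧ u ≠ w}, ⟨x, .inl rfl⟩, ⟨i, hi, hiv, hiw⟩, ?_,
              ?_, ?_, ?_⟩
            · ext u
              simp only [starWith, Set.mem_union, Set.mem_insert_iff, Set.mem_singleton_iff,
                Set.mem_ofPred_eq]
              tauto
            · rintro _ (rfl | rfl) _ (rfl | rfl) hne
              · exact absurd rfl hne
              · exact hnx
              · exact fun hh => hnx hh.symm
              · exact absurd rfl hne
            · rintro a ⟨h1, h2, h3⟩ b ⟨h4, h5, h6⟩ -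
              exact h.indep a b h1 h2 h3 h4 h5 h6
            · rintro _ (rfl | rfl) b ⟨h4, h5, h6⟩
              · exact h4
              · exact hz b h4 h5 h6
          have hmem := hF'.mem (.old z hzv hzw) trivial (by
            rw [← induces_image_iff (Set.insert_subset (old_mem_core hzv hzw) lift_subset),
              Set.image_insert_eq, image_lift hv hw]
            exact hcb)
          rcases hmem.2 with h1 | h1 | h1
          · exact hzx h1
          · exact hzx h1
          · exact K.loopless.irrefl z (hz z h1.1 hzv hzw)
  · intro F E hF hFn hE hEn heq u hu
    by_cases huv : u = v
    · subst huv
      have : SplitVertex.pendant ∈ splitMap u w x E := heq ▸ hu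
      exact this
    · by_cases huw : u = w
      · subst huw
        have : SplitVertex.copyPendant ∈ splitMap v u x E := heq ▸ hu
        exact this
      · by_cases hux : u = x ∧ w ∈ F
        · obtain ⟨rfl, hw⟩ := hux
          have : SplitVertex.copy ∈ splitMap v w u E :=
            heq ▸ (⟨hu, fun hv => hvw F hF hFn hv hw⟩ : u ∈ F ∧ v ∉ F)
          exact this.1
        · have : SplitVertex.old u huv huw ∈ splitMap v w x E :=
            heq ▸ (⟨hu, fun e hw => hux ⟨e, hw⟩⟩ : u ∈ F ∧ (u = x → w ∉ F))
          exact this.1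
  · intro F E hF hFn hE hEn
    constructor
    · rintro ⟨s, h1, h2⟩
      exact ⟨proj x s, hproj F s h1, hproj E s h2⟩
    · rintro ⟨u, h1, h2⟩
      have hcross : ∀ F E : Set U, K.IsBiclique F → F ≠ {v, w} → K.IsBiclique E → E ≠ {v, w} →
          w ∈ F → v ∈ E → (splitMap v w x F ∩ splitMap v w x E).Nonempty := by
        intro F E hF hFn hE hEn hw hv
        rw [h.eq_starWith' hF hFn hw, h.eq_starWith hE hEn hv, h.splitMap_starWith,
          h.splitMap_starWith']
        exact ⟨.old i hiv hiw, hi, .inr hi⟩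
      by_cases huv : u = v
      · subst huv
        exact ⟨.pendant, h1, h2⟩
      · by_cases huw : u = w
        · subst huw
          exact ⟨.copyPendant, h1, h2⟩
        · by_cases hux : u = x
          · subst hux
            by_cases hw : w ∈ F ∨ w ∈ E
            · by_cases hvE : v ∈ E
              · exact hcross F E hF hFn hE hEn (hw.resolve_right (hvw E hE hEn hvE)) hvE
              · by_cases hvF : v ∈ F
                · rw [Set.inter_comm]
                  exact hcross E F hE hEn hF hFn (hw.resolve_left (hvw F hF hFn hvF)) hvF
                · exact ⟨.copy, ⟨h1, hvF⟩, ⟨h2, hvE⟩⟩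
            · push Not at hw
              exact ⟨.old u huv huw, ⟨h1, fun _ => hw.1⟩, ⟨h2, fun _ => hw.2⟩⟩
          · exact ⟨.old u huv huw, ⟨h1, fun e => absurd e hux⟩, ⟨h2, fun e => absurd e hux⟩⟩

theorem nonempty_iso_splitGraph_induce (h : K.IsPendantTriangle v w x)
    (hz : ¬ ∃ z, z ≠ x ∧ ∀ i, K.Adj x i → i ≠ v → i ≠ w → K.Adj z i) :
    Nonempty (K.bicliqueGraph.induce {F | F.1 ≠ {v, w}} ≃g
      ((K.splitGraph v w x).induce {SplitVertex.copyPendant}ᶜ).bicliqueGraph) := by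
  obtain ⟨i, hi, hiv, hiw⟩ := h.nonempty
  have hX : core v w ⊆ {SplitVertex.copyPendant}ᶜ := fun s hs => hs.2
  have hpX : pendantStar K v w x ⊆ {SplitVertex.copyPendant}ᶜ := by
    rintro s hs rfl
    exact hs.elim
  have hproj : ∀ F s, s ∈ splitMap' v w x F → proj x s ∈ F := by
    intro F s hs
    cases s with
    | old u h1 h2 => exact hs
    | copy => exact hs.1
    | pendant => exact hs
    | copyPendant => exact hs.elim
  have hxv := h.not_mem_starWith_x
  refine (exists_bicliqueGraph_iso (K := K) (K' := K.splitGraph v w x) (p := fun F => F ≠ {v, w})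
    (X := {SplitVertex.copyPendant}ᶜ) (splitMap' v w x) ?_ ?_ ?_ ?_).elim fun φ _ => ⟨φ⟩
  · intro F hF hne
    by_cases hv : v ∈ F
    · rw [h.eq_starWith hF hne hv, splitMap'_starWith]
      exact (h.isBicliqueOn_pendantStar hpX).1
    · by_cases hw : w ∈ F
      · rw [h.eq_starWith' hF hne hw, h.splitMap'_starWith']
        refine h.isBicliqueOn_lift hX (h.induces_starWith (.inr (.inr rfl))) hxv.1 hxv.2
          fun u huv huw hins => ?_
        -- A vertex that extends the closed star at `x` is adjacent to `x` or to all its leaves.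
        by_contra hu
        have hux : u ≠ x := fun e => hu (.inl e)
        refine hz ⟨u, hux, fun j hj hjv hjw => ?_⟩
        have := hins.adj_iff (a := x) (b := j) (c := u) (.inr (.inl rfl))
          (.inr (.inr (.inr ⟨hj, hjv, hjw⟩))) (.inl rfl) hj
        by_contra hn
        exact hu (.inr (.inr ⟨this.2 fun hh => hn hh.symm, huv, huw⟩))
      · rw [splitMap'_eq_lift (E := F) hv (fun _ _ _ => Iff.rfl) Iff.rfl]
        exact h.isBicliqueOn_lift hX hF.1 hv hw fun u _ _ => (isBiclique_iff.1 hF).2 u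
  · intro F' hF'
    have hne : ∀ p, starWith K v w x p ≠ {v, w} := by
      intro p heq
      have : x ∈ ({v, w} : Set U) := heq ▸ Or.inl rfl
      rcases this with h1 | h1
      exacts [h.ne_vx h1.symm, h.ne_wx h1.symm]
    by_cases hp : SplitVertex.pendant ∈ F'
    · refine ⟨_, h.isBiclique_starWith, hne v, ?_⟩
      rw [splitMap'_starWith]
      exact ((h.isBicliqueOn_pendantStar hpX).2 F' hF' hp).symm
    · have hcore : F' ⊆ core v w := fun s hs =>
        ⟨fun e => hp (e ▸ hs), fun e => hF'.subset hs e⟩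
      obtain ⟨F, hv, hw, rfl, hF | rfl⟩ := h.exists_eq_lift hX hF' hcore
      · exact ⟨F, hF, fun heq => hv (heq ▸ Or.inl rfl),
          splitMap'_eq_lift hv (fun _ _ _ => Iff.rfl) Iff.rfl⟩
      · exact ⟨_, h.isBiclique_starWith', hne w, h.splitMap'_starWith'⟩
  · intro F E hF hFn hE hEn heq u hu
    by_cases huv : u = v
    · subst huv
      have : SplitVertex.pendant ∈ splitMap' u w x E := heq ▸ hu
      exact this
    · by_cases huw : u = w
      · -- Otherwise `E` would be the closed star at `x` without `v` and `w`, which `v` extends.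
        subst huw
        by_contra hwE
        have hFe := h.eq_starWith' hF hFn hu
        have hvE : v ∉ E := by
          intro hvE
          have : SplitVertex.pendant ∈ splitMap' v u x F := heq ▸ hvE
          rw [hFe, h.splitMap'_starWith'] at this
          exact this.1.1 rfl
        have hEe : E = starWith K v u x x := by
          rw [hFe, h.splitMap'_starWith', splitMap'_eq_lift (E := E) hvE
            (fun _ _ _ => Iff.rfl) Iff.rfl] at heq
          rw [← image_lift (x := x) hvE hwE, ← heq, image_lift hxv.1 hxv.2]
        refine hvE ((isBiclique_iff.1 hE).2 v ((h.induces_starWith (.inl rfl)).subset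
          (a := x) (b := i) ?_ ?_ ?_ hi))
        · rw [hEe]
          rintro t (rfl | rfl | rfl | ht)
          exacts [.inr (.inl rfl), .inl rfl, .inl rfl, .inr (.inr ht)]
        · rw [hEe]
          exact .inr (.inl rfl)
        · rw [hEe]
          exact .inr (.inr (.inr ⟨hi, hiv, hiw⟩))
      · have : SplitVertex.old u huv huw ∈ splitMap' v w x E := heq ▸ hu
        exact this
  · intro F E hF hFn hE hEn
    constructor
    · rintro ⟨s, h1, h2⟩
      exact ⟨proj x s, hproj F s h1, hproj E s h2⟩
    · rintro ⟨u, h1, h2⟩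
      by_cases huv : u = v
      · subst huv
        exact ⟨.pendant, h1, h2⟩
      · by_cases huw : u = w
        · subst huw
          have hxw : ∀ F : Set U, K.IsBiclique F → F ≠ {v, u} → u ∈ F → x ∈ F :=
            fun F hF hFn hu => by
              rw [h.eq_starWith' hF hFn hu]
              exact .inl rfl
          exact ⟨.old x h.ne_vx.symm h.ne_wx.symm, hxw F hF hFn h1, hxw E hE hEn h2⟩
        · exact ⟨.old u huv huw, h1, h2⟩

end IsPendantTriangle

/-! ### Deletion of a vertex of degree two -/

theorem isBiclique_image_iff (φ : K ≃g K') (F : Set U) :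
    K'.IsBiclique (φ '' F) ↔ K.IsBiclique F := by
  have key : ∀ E : Set U, K'.InducesCompleteBipartite (φ '' E) ↔ K.InducesCompleteBipartite E :=
    fun E => inducesCompleteBipartite_image_iff fun _ _ _ _ => φ.map_adj_iff
  simp only [isBiclique_iff, key, φ.surjective.forall, ← Set.image_insert_eq,
    φ.injective.mem_set_image]

/-- Isomorphic graphs have isomorphic biclique graphs. -/
def bicliqueGraphCongr (φ : K ≃g K') : K.bicliqueGraph ≃g K'.bicliqueGraph where
  toEquiv := (Equiv.Set.congr φ.toEquiv).subtypeEquiv fun F => (isBiclique_image_iff φ F).symm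
  map_rel_iff' {F E} := by
    refine and_congr (Equiv.apply_eq_iff_eq _).not ?_
    change (φ '' F.1 ∩ φ '' E.1).Nonempty ↔ _
    rw [← Set.image_inter φ.injective, Set.image_nonempty]

theorem isBicliqueGraph_of_iso [Finite U] (hK : K.Connected) (φ : G ≃g K.bicliqueGraph) :
    G.IsBicliqueGraph := by
  have := Fintype.ofFinite U
  refine ⟨Fintype.card U, K.overFin rfl, (K.overFinIso rfl).connected_iff.1 hK,
    ⟨φ.trans (bicliqueGraphCongr (K.overFinIso rfl))⟩⟩

/-- Deleting a vertex of `G` amounts to deleting its image under an isomorphism. -/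
def induceComplIso (ε : G ≃g K.bicliqueGraph) (q : W) :
    G.induce {q}ᶜ ≃g K.bicliqueGraph.induce {F | F.1 ≠ (ε q).1} where
  toEquiv := ε.toEquiv.subtypeEquiv fun u => by
    change u ≠ q ↔ (ε u).1 ≠ (ε q).1
    rw [Ne, Ne, Subtype.ext_iff.symm, ε.injective.eq_iff]
  map_rel_iff' := ε.map_rel_iff

theorem exists_hasTwoNeighbors (ε : G ≃g K.bicliqueGraph) {q : W}
    (hq : (G.neighborSet q).ncard = 2) : ∃ C D, K.HasTwoNeighbors (ε q).1 C D := by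
  obtain ⟨c, d, hcd, hN⟩ := Set.ncard_eq_two.1 hq
  have hN' : ∀ u, G.Adj q u ↔ u = c ∨ u = d := fun u => by simpa using Set.ext_iff.1 hN u
  have hadj : ∀ u, G.Adj q u ↔ ε q ≠ ε u ∧ ((ε q).1 ∩ (ε u).1).Nonempty := fun u =>
    (ε.map_rel_iff (a := q) (b := u)).symm
  have hc := (hadj c).1 ((hN' c).2 (.inl rfl))
  have hd := (hadj d).1 ((hN' d).2 (.inr rfl))
  refine ⟨(ε c).1, (ε d).1, (ε q).2, (ε c).2, (ε d).2, fun h => hc.1 (Subtype.ext h).symm,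
    fun h => hd.1 (Subtype.ext h).symm, fun h => hcd (ε.injective (Subtype.ext h)), hc.2, hd.2,
    fun F hF hm => ?_⟩
  obtain ⟨u, hu⟩ := ε.surjective ⟨F, hF⟩
  have hF' : F = (ε u).1 := by rw [hu]
  by_cases huq : u = q
  · exact .inl (by rw [hF', huq])
  · right
    rcases (hN' u).1 ((hadj u).2 ⟨fun h => huq (ε.injective h).symm, hF' ▸ hm⟩) with rfl | rfl
    exacts [.inl hF', .inr hF']

theorem isBicliqueOn_pathGraph_iff (F : Set (Fin 4)) :
    (pathGraph 4).IsBicliqueOn Set.univ F ↔ F = {0, 1, 2} ∨ F = {1, 2, 3} := by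
  have h01 : (pathGraph 4).Adj 0 1 := by simp [pathGraph_adj]
  have h12 : (pathGraph 4).Adj 1 2 := by simp [pathGraph_adj]
  have h23 : (pathGraph 4).Adj 2 3 := by simp [pathGraph_adj]
  have h02 : ¬ (pathGraph 4).Adj 0 2 := by simp [pathGraph_adj]
  have h13 : ¬ (pathGraph 4).Adj 1 3 := by simp [pathGraph_adj]
  have h03 : ¬ (pathGraph 4).Adj 0 3 := by simp [pathGraph_adj]
  have hl := inducesCompleteBipartite_path h01 h12 h02
  have hr := inducesCompleteBipartite_path h12 h23 h13
  have hnot : ∀ E, (pathGraph 4).InducesCompleteBipartite E → 0 ∈ E → 3 ∉ E := by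
    intro E hE h0 h3
    obtain ⟨t, ht, h0t⟩ := hE.exists_adj h0
    have ht1 : t = 1 := by
      simp only [pathGraph_adj, Fin.val_zero] at h0t
      exact Fin.ext (by simp; omega)
    subst ht1
    exact h03 ((hE.adj_iff h0 ht h3 h0t).2 h13)
  have hcov : ∀ u : Fin 4, u = 0 ∨ u = 1 ∨ u = 2 ∨ u = 3 := by decide
  constructor
  · intro hF
    by_cases h0 : 0 ∈ F
    · refine .inl (hF.eq_of_subset hl (Set.subset_univ _) fun u hu => ?_)
      have := hnot F hF.induces h0
      rcases hcov u with rfl | rfl | rfl | rfl <;> simp_all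
    · refine .inr (hF.eq_of_subset hr (Set.subset_univ _) fun u hu => ?_)
      rcases hcov u with rfl | rfl | rfl | rfl <;> simp_all
  · rintro (rfl | rfl)
    · refine ⟨Set.subset_univ _, hl, fun u _ hins => ?_⟩
      rcases hcov u with rfl | rfl | rfl | rfl
      · simp
      · simp
      · simp
      · exact absurd (Set.mem_insert _ _) (hnot _ hins (by simp))
    · refine ⟨Set.subset_univ _, hr, fun u _ hins => ?_⟩
      rcases hcov u with rfl | rfl | rfl | rfl
      · exact absurd (by simp) (hnot _ hins (Set.mem_insert _ _))
      · simp
      · simp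
      · simp

/-- If `B`, `C`, `D` are all the bicliques, then deleting `B` leaves an edge, which is the biclique
graph of the path on four vertices. -/
theorem HasFewBicliques.isBicliqueGraph {B C D : Set U} (hf : K.HasFewBicliques B C D)
    (h : K.HasTwoNeighbors B C D) (φ : G ≃g K.bicliqueGraph.induce {F | F.1 ≠ B}) :
    G.IsBicliqueGraph := by
  classical
  have hF : ∀ F, K.IsBiclique F → F ≠ B → F = C ∨ F = D := fun F hF hne =>
    (h.cover F hF (hf.meetB F hF)).resolve_left hne
  have hne : ({0, 1, 2} : Set (Fin 4)) ≠ {1, 2, 3} := fun heq => by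
    have : (0 : Fin 4) ∈ ({1, 2, 3} : Set (Fin 4)) := heq ▸ Or.inl rfl
    simp at this
  let f : Set U → Set (Fin 4) := fun F => if F = C then {0, 1, 2} else {1, 2, 3}
  have hC : f C = {0, 1, 2} := if_pos rfl
  have hD : f D = {1, 2, 3} := if_neg h.ne_CD.symm
  refine (exists_bicliqueGraph_iso (K := K) (K' := pathGraph 4) (p := fun F => F ≠ B)
    (X := Set.univ) f ?_ ?_ ?_ ?_).elim fun ψ _ => isBicliqueGraph_of_iso
      ((induceUnivIso (pathGraph 4)).connected_iff.2 (pathGraph_connected 3)) (φ.trans ψ)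
  · intro F h1 h2
    rw [isBicliqueOn_pathGraph_iff]
    rcases hF F h1 h2 with rfl | rfl
    exacts [.inl hC, .inr hD]
  · intro F' hF'
    rcases (isBicliqueOn_pathGraph_iff F').1 hF' with rfl | rfl
    exacts [⟨C, h.isC, h.ne_CB, hC⟩, ⟨D, h.isD, h.ne_DB, hD⟩]
  · intro F E h1 h2 h3 h4 heq
    rcases hF F h1 h2 with rfl | rfl <;> rcases hF E h3 h4 with rfl | rfl
    · exact subset_rfl
    · exact absurd (hC ▸ hD ▸ heq) hne
    · exact absurd (hC ▸ hD ▸ heq.symm) hne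
    · exact subset_rfl
  · intro F E h1 h2 h3 h4
    refine iff_of_true ⟨1, ?_, ?_⟩ ?_
    · rcases hF F h1 h2 with rfl | rfl
      · simp [hC]
      · simp [hD]
    · rcases hF E h3 h4 with rfl | rfl
      · simp [hC]
      · simp [hD]
    · obtain ⟨t, htC, htD⟩ := hf.meet
      rcases hF F h1 h2 with rfl | rfl <;> rcases hF E h3 h4 with rfl | rfl
      exacts [⟨t, htC, htC⟩, ⟨t, htC, htD⟩, ⟨t, htD, htC⟩, ⟨t, htD, htD⟩]

theorem finite_splitVertex [Finite U] (v w : U) : Finite (SplitVertex v w) := by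
  let g : SplitVertex v w → U ⊕ Fin 3 := fun s =>
    match s with
    | .old u _ _ => .inl u
    | .copy => .inr 0
    | .pendant => .inr 1
    | .copyPendant => .inr 2
  refine Finite.of_injective g fun s t hst => ?_
  cases s <;> cases t <;> simp_all [g]

/-- The deletion of a vertex of degree two for a graph without false twins. The last alternative
collects the small graphs that have no explicit description. -/
theorem delete_of_no_falseTwins [Finite U] (hK : K.Connected)
    (htw : ∀ a b, K.neighborSet a = K.neighborSet b → a = b) (ε : G ≃g K.bicliqueGraph) {q : W}
    (hq : (G.neighborSet q).ncard = 2) :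
    (∃ a b c : U, a ≠ c ∧ (ε q).1 = {b} ∪ {a, c} ∧ K.neighborSet a = {b} ∧
        K.neighborSet b = {a, c} ∧ (K.induce {a}ᶜ).Connected ∧
        Nonempty (G.induce {q}ᶜ ≃g (K.induce {a}ᶜ).bicliqueGraph)) ∨
      (∃ v w x : U, v ≠ w ∧ v ≠ x ∧ w ≠ x ∧ (ε q).1 = {v, w} ∧
        K.neighborSet v = {w, x} ∧ K.neighborSet w = {v, x} ∧
        K.IsIndepSet (K.neighborSet x \ {v, w}) ∧
        ((∃ z : U, z ≠ x ∧ ∀ i ∈ K.neighborSet x \ {v, w}, K.Adj z i) →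
          (K.splitGraph v w x).Connected ∧
          Nonempty (G.induce {q}ᶜ ≃g (K.splitGraph v w x).bicliqueGraph)) ∧
        ((¬ ∃ z : U, z ≠ x ∧ ∀ i ∈ K.neighborSet x \ {v, w}, K.Adj z i) →
          ((K.splitGraph v w x).induce {SplitVertex.copyPendant}ᶜ).Connected ∧
          Nonempty (G.induce {q}ᶜ ≃g
            ((K.splitGraph v w x).induce {SplitVertex.copyPendant}ᶜ).bicliqueGraph))) ∨
      (Nat.card U ≤ 6 ∧ (G.induce {q}ᶜ).IsBicliqueGraph) := by
  obtain ⟨C, D, h⟩ := exists_hasTwoNeighbors ε hq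
  have φ := induceComplIso ε q
  rcases h.structure_or hK htw with ⟨a, b, c, hac, hB, ha, hb⟩ |
    ⟨v, w, x, hvw, hvx, hwx, hB, hv, hw, hind, ⟨i, hi, hi'⟩⟩ | hf
  · rw [hB] at φ
    obtain ⟨ψ⟩ := nonempty_iso_of_pendant htw hac ha hb
    exact .inl ⟨a, b, c, hac, hB, ha, hb, connected_induce_of_pendant hK hac ha hb, ⟨φ.trans ψ⟩⟩
  · rw [hB] at φ
    have hT : K.IsPendantTriangle v w x :=
      { ne_vw := hvw
        ne_vx := hvx
        ne_wx := hwx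
        adj_v := fun u => by simpa using Set.ext_iff.1 hv u
        adj_w := fun u => by simpa using Set.ext_iff.1 hw u
        indep := fun i j h1 h2 h3 h4 h5 h6 hij =>
          hind ⟨h1, by simp [h2, h3]⟩ ⟨h4, by simp [h5, h6]⟩ hij.ne hij
        nonempty := ⟨i, hi, by simpa using hi'⟩ }
    have hz : (∃ z : U, z ≠ x ∧ ∀ i ∈ K.neighborSet x \ {v, w}, K.Adj z i) ↔
        ∃ z, z ≠ x ∧ ∀ i, K.Adj x i → i ≠ v → i ≠ w → K.Adj z i := by
      simp only [Set.mem_sdiff, mem_neighborSet, Set.mem_insert_iff, Set.mem_singleton_iff, not_or,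
        and_imp]
    refine .inr (.inl ⟨v, w, x, hvw, hvx, hwx, hB, hv, hw, hind, ?_, ?_⟩)
    · rw [hz]
      intro hz'
      obtain ⟨ψ⟩ := hT.nonempty_iso_splitGraph hz'
      exact ⟨hT.connected_splitGraph hK, ⟨(φ.trans ψ).trans (bicliqueGraphCongr (induceUnivIso _))⟩⟩
    · rw [hz]
      intro hz'
      obtain ⟨ψ⟩ := hT.nonempty_iso_splitGraph_induce hz'
      exact ⟨hT.connected_splitGraph_induce hK, ⟨φ.trans ψ⟩⟩
  · exact .inr (.inr ⟨hf.card_le, hf.isBicliqueGraph h φ⟩)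

end SimpleGraph

theorem theorem4p1 {V W : Type*} [Finite V] (H : SimpleGraph V) (hH : H.Connected)
    (G : SimpleGraph W) (e : G ≃g H.bicliqueGraph) (q : W)
    (hq : (G.neighborSet q).ncard = 2) :
    (G.induce {q}ᶜ).IsBicliqueGraph ∧
    ∀ R : Set V, H.IsFalseTwinTransversal R → 7 ≤ R.ncard →
      (∃ a b c : R, a ≠ c ∧ {r : R | (r : V) ∈ (e q).1} = {b} ∪ {a, c} ∧
        (H.induce R).neighborSet a = {b} ∧ (H.induce R).neighborSet b = {a, c} ∧
        ((H.induce R).induce {a}ᶜ).Connected ∧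
        Nonempty (G.induce {q}ᶜ ≃g ((H.induce R).induce {a}ᶜ).bicliqueGraph)) ∨
      (∃ v w x : R, v ≠ w ∧ v ≠ x ∧ w ≠ x ∧ {r : R | (r : V) ∈ (e q).1} = {v, w} ∧
        (H.induce R).neighborSet v = {w, x} ∧ (H.induce R).neighborSet w = {v, x} ∧
        (H.induce R).IsIndepSet ((H.induce R).neighborSet x \ {v, w}) ∧
        ((∃ z : R, z ≠ x ∧
            ∀ i ∈ (H.induce R).neighborSet x \ {v, w}, (H.induce R).Adj z i) →
          ((H.induce R).splitGraph v w x).Connected ∧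
          Nonempty (G.induce {q}ᶜ ≃g ((H.induce R).splitGraph v w x).bicliqueGraph)) ∧
        ((¬ ∃ z : R, z ≠ x ∧
            ∀ i ∈ (H.induce R).neighborSet x \ {v, w}, (H.induce R).Adj z i) →
          (((H.induce R).splitGraph v w x).induce
            {SimpleGraph.SplitVertex.copyPendant}ᶜ).Connected ∧
          Nonempty (G.induce {q}ᶜ ≃g (((H.induce R).splitGraph v w x).induce
            {SimpleGraph.SplitVertex.copyPendant}ᶜ).bicliqueGraph))) := by
  have key : ∀ R : Set V, H.IsFalseTwinTransversal R →
      ∃ ε : G ≃g (H.induce R).bicliqueGraph, (ε q).1 = {r : R | (r : V) ∈ (e q).1} := by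
    intro R hR
    obtain ⟨φ, hφ⟩ := hR.exists_iso
    exact ⟨e.trans φ, hφ (e q)⟩
  constructor
  · obtain ⟨R, hR⟩ := H.exists_isFalseTwinTransversal
    obtain ⟨ε, -⟩ := key R hR
    rcases SimpleGraph.delete_of_no_falseTwins (hR.connected_induce hH) hR.eq_of_neighborSet_eq ε hq
      with ⟨a, b, c, -, -, -, -, hcon, ⟨φ⟩⟩ | ⟨v, w, x, -, -, -, -, -, -, -, h1, h2⟩ | ⟨-, h⟩
    · exact SimpleGraph.isBicliqueGraph_of_iso hcon φ
    · have := SimpleGraph.finite_splitVertex v w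
      by_cases hz : ∃ z : R, z ≠ x ∧
          ∀ i ∈ (H.induce R).neighborSet x \ {v, w}, (H.induce R).Adj z i
      · obtain ⟨hcon, ⟨φ⟩⟩ := h1 hz
        exact SimpleGraph.isBicliqueGraph_of_iso hcon φ
      · obtain ⟨hcon, ⟨φ⟩⟩ := h2 hz
        exact SimpleGraph.isBicliqueGraph_of_iso hcon φ
    · exact h
  · intro R hR hcard
    obtain ⟨ε, hε⟩ := key R hR
    rw [← hε]
    rcases SimpleGraph.delete_of_no_falseTwins (hR.connected_induce hH) hR.eq_of_neighborSet_eq ε hq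
      with h | h | ⟨h, -⟩
    · exact .inl h
    · exact .inr h
    · rw [Nat.card_coe_set_eq] at h
      omega
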